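/- Let $N\ge 1$, let $\Omega\subset\mathbb{R}^N$ be a bounded open set, $p\in(1,\infty)$, $s\in(0,1]$, and $\rho(x)=\operatorname{dist}(x,\partial\Omega)$. For $0<s<1$ let $W_0^{s,p}(\Omega)=\{u\in W^{s,p}(\mathbb{R}^N): u=0\text{ a.e. in }\mathbb{R}^N\setminus\Omega\}$ with $$\|u\|^p=\int_{\mathbb{R}^{2N}}\frac{|u(x)-u(y)|^p}{|x-y|^{N+sp}}\,dx\,dy,\qquad \langle A(u),\xi\rangle=\int_{\mathbb{R}^{2N}}\frac{|u(x)-u(y)|^{p-2}(u(x)-u(y))(\xi(x)-\xi(y))}{|x-y|^{N+sp}}\,dx\,dy ;$$ for $s=1$ let $W_0^{1,p}(\Omega)$ be the usual Sobolev space (the closure of $C_c^\infty(\Omega)$ in $W^{1,p}(\Omega)$), $\|u\|^p=\int_\Omega|\nabla u|^p\,dx$ and $\langle A(u),\xi\rangle=\int_\Omega|\nabla u|^{p-2}\nabla u\cdot\nabla\xi\,dx$. Let $p_s^*=\frac{Np}{N-sp}$ if $sp<N$ and $p_s^*=\infty$ otherwise. Let $h$ belong to the class $\widetilde{\mathscr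 W}_p$, that is, $h$ is measurable on $\Omega$ and $h\rho^{sa}\in L^r(\Omega)$ for some $a\in[0,1]$ and $r\in(1,\infty)$ with $\frac1r+\frac ap+\frac{p-a}{p_s^*}<1$ (with $\frac{p-a}{\infty}=0$). Put $$\lambda_1=\inf\Big\{\|u\|^p:\ u\in W_0^{s,p}(\Omega),\ \int_\Omega h|u|^p\,dx=1\Big\}.$$ Let $\lambda\in\mathbb{R}$ and let $v$ be an eigenfunction with eigenvalue $\lambda$ of the problem $(-\Delta)_p^s u=\lambda h|u|^{p-2}u$ in $\Omega$, $u=0$ in $\mathbb{R}^N\setminus\Omega$ (for $s=1$, the Dirichlet problem for the $p$-Laplacian); that is, $0\ne v\in W_0^{s,p}(\Omega)$, the functional $\xi\mapsto\lambda\int_\Omega h|v|^{p-2}v\,\xi\,dx$ is well defined and bounded on $W_0^{s,p}(\Omega)$, and it equals $\langle A(v),\xi\rangle$ for all $\xi\in W_0^{s,p}(\Omega)$. If $v>0$ a.e. in $\Omega$ and $\int_\Omega h v^p\,dx>0$, then $\lambda=\lambda_1$. -/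

import Mathlib

open MeasureTheory Filter Topology
open scoped ENNReal ContDiff InnerProductSpace

namespace FracPLaplace

/-- `ℝ^N` with its Euclidean norm. -/
abbrev Eucl (N : ℕ) : Type := EuclideanSpace ℝ (Fin N)

variable {N : ℕ}

/-! ### The space `W₀^{s,p}(Ω)` for `0 < s < 1` -/

/-- The Gagliardo integrand `|u(x) - u(y)|^p / |x - y|^(N + s p)` on `ℝ^N × ℝ^N`. -/
noncomputable def gagliardoIntegrand (s p : ℝ) (u : Eucl N → ℝ) (z : Eucl N × Eucl N) : ℝ :=
  |u z.1 - u z.2| ^ p / ‖z.1 - z.2‖ ^ ((N : ℝ) + s * p)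

/-- `u ∈ W^{s,p}(ℝ^N)` (`0 < s < 1`): `u ∈ L^p(ℝ^N)` with finite Gagliardo seminorm. -/
def MemFracSobolev (s p : ℝ) (u : Eucl N → ℝ) : Prop :=
  MemLp u (ENNReal.ofReal p) volume ∧ Integrable (gagliardoIntegrand s p u) volume

/-- `u ∈ W₀^{s,p}(Ω)` (`0 < s < 1`): `u ∈ W^{s,p}(ℝ^N)` and `u = 0` (a.e.) in `ℝ^N ∖ Ω`. -/
def MemFracSobolevZero (Ω : Set (Eucl N)) (s p : ℝ) (u : Eucl N → ℝ) : Prop :=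
  MemFracSobolev s p u ∧ ∀ᵐ x ∂volume, x ∉ Ω → u x = 0

/-! ### The space `W₀^{1,p}(Ω)` -/

/-- Test functions: `φ ∈ C_c^∞(Ω)`. -/
def IsTestFunction (Ω : Set (Eucl N)) (φ : Eucl N → ℝ) : Prop :=
  ContDiff ℝ ∞ φ ∧ HasCompactSupport φ ∧ tsupport φ ⊆ Ω

/-- `g` is a weak (distributional) gradient of `u` in the open set `Ω`. -/
def IsWeakGradient (Ω : Set (Eucl N)) (u : Eucl N → ℝ) (g : Eucl N → Eucl N) : Prop :=
  LocallyIntegrableOn u Ω volume ∧ LocallyIntegrableOn g Ω volume ∧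
    ∀ φ : Eucl N → ℝ, IsTestFunction Ω φ →
      ∫ x in Ω, u x • gradient φ x = -∫ x in Ω, φ x • g x

open Classical in
/-- The weak gradient `∇u` of `u` in `Ω` (unique up to a.e. equality in `Ω`); by convention
it is `0` if `u` has no weak gradient. -/
noncomputable def weakGradient (Ω : Set (Eucl N)) (u : Eucl N → ℝ) : Eucl N → Eucl N :=
  if hu : ∃ g, IsWeakGradient Ω u g then hu.choose else 0

/-- `u ∈ W₀^{1,p}(Ω)`, with `u` extended by `0` outside `Ω`: `u` has a weak gradient in `L^p(Ω)`
and is the limit of functions of class `C_c^∞(Ω)` in the norm of `W^{1,p}(Ω)`. -/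
def MemSobolevOneZero (Ω : Set (Eucl N)) (p : ℝ) (u : Eucl N → ℝ) : Prop :=
  MemLp u (ENNReal.ofReal p) volume ∧ (∀ᵐ x ∂volume, x ∉ Ω → u x = 0) ∧
    ∃ g : Eucl N → Eucl N, IsWeakGradient Ω u g ∧
      MemLp g (ENNReal.ofReal p) (volume.restrict Ω) ∧
      ∃ φ : ℕ → Eucl N → ℝ, (∀ n, IsTestFunction Ω (φ n)) ∧
        Tendsto (fun n => eLpNorm (fun x => φ n x - u x) (ENNReal.ofReal p) (volume.restrict Ω))
          atTop (𝓝 0) ∧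
        Tendsto (fun n => eLpNorm (fun x => gradient (φ n) x - g x) (ENNReal.ofReal p)
          (volume.restrict Ω)) atTop (𝓝 0)

/-! ### `W₀^{s,p}(Ω)` for `0 < s ≤ 1`, its norm and the weak form of the operator -/

open Classical in
/-- `u ∈ W₀^{s,p}(Ω)`: the fractional space for `0 < s < 1`, the usual Sobolev space
`W₀^{1,p}(Ω)` for `s = 1`. -/
def MemW0 (Ω : Set (Eucl N)) (s p : ℝ) (u : Eucl N → ℝ) : Prop :=
  if s = 1 then MemSobolevOneZero Ω p u else MemFracSobolevZero Ω s p u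

open Classical in
/-- The norm `‖u‖` of `W₀^{s,p}(Ω)`: the Gagliardo norm for `0 < s < 1`,
`(∫_Ω |∇u|^p)^(1/p)` for `s = 1`. -/
noncomputable def normW0 (Ω : Set (Eucl N)) (s p : ℝ) (u : Eucl N → ℝ) : ℝ :=
  (if s = 1 then ∫ x in Ω, ‖weakGradient Ω u x‖ ^ p
    else ∫ z : Eucl N × Eucl N, gagliardoIntegrand s p u z) ^ (1 / p)

open Classical in
/-- `⟨A(u), v⟩`, the weak form of the fractional `p`-Laplacian for `0 < s < 1`, and of the
`p`-Laplacian for `s = 1`. -/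
noncomputable def formA (Ω : Set (Eucl N)) (s p : ℝ) (u v : Eucl N → ℝ) : ℝ :=
  if s = 1 then
    ∫ x in Ω, ‖weakGradient Ω u x‖ ^ (p - 2) * ⟪weakGradient Ω u x, weakGradient Ω v x⟫_ℝ
  else
    ∫ z : Eucl N × Eucl N,
      |u z.1 - u z.2| ^ (p - 2) * (u z.1 - u z.2) * (v z.1 - v z.2)
        / ‖z.1 - z.2‖ ^ ((N : ℝ) + s * p)

/-! ### Weak solutions and eigenfunctions -/

/-- The function `F` on `Ω` belongs to the dual `W₀^{-s,p'}(Ω)` of `W₀^{s,p}(Ω)`: the functional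
`v ↦ ∫_Ω F v` is defined and bounded on `W₀^{s,p}(Ω)`. -/
def MemDualW0 (Ω : Set (Eucl N)) (s p : ℝ) (F : Eucl N → ℝ) : Prop :=
  ∃ C : ℝ, ∀ v : Eucl N → ℝ, MemW0 Ω s p v →
    Integrable (fun x => F x * v x) (volume.restrict Ω) ∧
      |∫ x in Ω, F x * v x| ≤ C * normW0 Ω s p v

/-- `u` is a weak solution of `(-Δ)_p^s u = f(x, u)` in `Ω`, `u = 0` in `ℝ^N ∖ Ω`. -/
def IsWeakSolution (Ω : Set (Eucl N)) (s p : ℝ) (f : Eucl N → ℝ → ℝ) (u : Eucl N → ℝ) : Prop :=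
  MemW0 Ω s p u ∧ MemDualW0 Ω s p (fun x => f x (u x)) ∧
    ∀ v : Eucl N → ℝ, MemW0 Ω s p v → formA Ω s p u v = ∫ x in Ω, f x (u x) * v x

/-- `u` is an eigenfunction, with eigenvalue `lam`, of
`(-Δ)_p^s u = lam h(x) |u|^{p-2} u` in `Ω`, `u = 0` in `ℝ^N ∖ Ω`: a nontrivial weak solution. -/
def IsEigenfunction (Ω : Set (Eucl N)) (s p : ℝ) (h : Eucl N → ℝ) (lam : ℝ) (u : Eucl N → ℝ) :
    Prop :=
  ¬ (u =ᵐ[volume] 0) ∧ IsWeakSolution Ω s p (fun x t => lam * h x * |t| ^ (p - 2) * t) u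

/-- `λ₁ = inf { ‖u‖^p : u ∈ W₀^{s,p}(Ω), ∫_Ω h |u|^p = 1 }`. -/
noncomputable def firstEigenvalue (Ω : Set (Eucl N)) (s p : ℝ) (h : Eucl N → ℝ) : ℝ :=
  sInf {c : ℝ | ∃ u : Eucl N → ℝ, MemW0 Ω s p u ∧ ∫ x in Ω, h x * |u x| ^ p = 1 ∧
    c = normW0 Ω s p u ^ p}

/-! ### The class of weights -/

/-- The critical exponent `p_s^* = N p / (N - s p)` if `s p < N`, and `∞` otherwise. -/
noncomputable def critExponent (N : ℕ) (s p : ℝ) : ℝ≥0∞ :=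
  if s * p < N then ENNReal.ofReal (N * p / (N - s * p)) else ∞

/-- The distance `ρ(x)` from `x` to the boundary of `Ω`. -/
noncomputable def bdryDist (Ω : Set (Eucl N)) (x : Eucl N) : ℝ :=
  Metric.infDist x (frontier Ω)

/-- The class `W̃_q`: measurable `h` on `Ω` such that `h ρ^{s a} ∈ L^r(Ω)` for some `a ∈ [0, 1]`
and `r ∈ (1, ∞)` with `1 / r + a / p + (max {p, q} - a) / p_s^* < 1`. -/
def WeightTilde (Ω : Set (Eucl N)) (s p q : ℝ) (h : Eucl N → ℝ) : Prop :=
  AEMeasurable h (volume.restrict Ω) ∧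
    ∃ a r : ℝ, 0 ≤ a ∧ a ≤ 1 ∧ 1 < r ∧
      1 / r + a / p + (max p q - a) * ((critExponent N s p)⁻¹).toReal < 1 ∧
      MemLp (fun x => h x * bdryDist Ω x ^ (s * a)) (ENNReal.ofReal r) (volume.restrict Ω)

end FracPLaplace

/-!
The idea is Picone's inequality: for `u` arbitrary and `v > 0`,
`⟨A(v), |u|^p / v^(p-1)⟩ ≤ ‖u‖^p`. If `v` is an eigenfunction with eigenvalue `lam`, the left side
equals `lam ∫ h v^(p-1) |u|^p / v^(p-1) = lam ∫ h |u|^p`, so `lam ≤ ‖u‖^p` whenever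
`∫ h |u|^p = 1`. Testing the equation with `v` itself gives `‖v‖^p = lam ∫ h v^p`, so a multiple of
`v` attains the value `lam`; hence `lam` is the minimum that defines `firstEigenvalue`.

The function `|u|^p / v^(p-1)` need not belong to `W₀^{s,p}(Ω)`. It is replaced by
`piconeProfile p ε (u, v) = |g(u)|^p / (v + ε)^(p-1)`, where `g(t) = arctan(ε t) / ε` is a bounded
contraction. The profile is a `C¹` function of two variables with bounded derivatives vanishing at
the origin (`HasBoundedPartials`), and such functions map `W₀^{s,p}(Ω)²` to `W₀^{s,p}(Ω)`
(`MemW0.comp`). For `s < 1` this is a pointwise bound of the Gagliardo integrand; for `s = 1` it is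
the chain rule `MemSobolevOneZero.comp`, proved by density, with a mollification
(`exists_isTestFunction_approx`) to return from `C¹` to smooth test functions. Picone's inequality
survives the regularization because `g` is a contraction: the integrands are compared pointwise by
`picone_discrete` for `s < 1` and by `picone_inner` for `s = 1` (`formA_piconeProfile_le`).
Finally `ε → 0` by dominated convergence with the dominating function `|lam| |h| |u|^p`
(`mul_integral_le_normW0_rpow`), which is integrable as soon as `∫ h |u|^p ≠ 0`.
-/

namespace FracPLaplace

/-! ### Pointwise Picone inequalities -/

theorem young_rpow_sub_one {p A B : ℝ} (hp : 1 < p) (hA : 0 ≤ A) (hB : 0 ≤ B) :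
    p * A ^ (p - 1) * B ≤ (p - 1) * A ^ p + B ^ p := by
  have hpq := Real.HolderConjugate.conjExponent hp
  have h := Real.young_inequality_of_nonneg (Real.rpow_nonneg hA (p - 1)) hB hpq.symm
  have h1 : (p - 1) * p.conjExponent = p := by
    unfold Real.conjExponent; field_simp [(sub_pos.2 hp).ne']
  rw [← Real.rpow_mul hA, h1] at h
  have h2 : A ^ p / p.conjExponent = (p - 1) * A ^ p / p := by
    unfold Real.conjExponent; field_simp [(sub_pos.2 hp).ne']
  rw [h2, ← add_div, le_div_iff₀ (by linarith)] at h
  linarith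

/-- The local Picone inequality. With `X = ∇u`, `Y = ∇v`, `t = |u| / v`, the vector
`α • X + β • Y` is the gradient of `|u|^p / v^(p-1)`, possibly after a contraction has been
applied to `u`. -/
theorem picone_inner {E : Type*} [NormedAddCommGroup E] [InnerProductSpace ℝ E] {p t α β : ℝ}
    (hp : 1 < p) (ht : 0 ≤ t) (hα : |α| ≤ p * t ^ (p - 1)) (hβ : β = -((p - 1) * t ^ p))
    (X Y : E) :
    ‖Y‖ ^ (p - 2) * ⟪Y, α • X + β • Y⟫_ℝ ≤ ‖X‖ ^ p := by
  rcases eq_or_ne Y 0 with rfl | hY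
  · simp only [inner_zero_left, mul_zero]; positivity
  have hY' : 0 < ‖Y‖ := norm_pos_iff.2 hY
  have h1 : ‖Y‖ ^ (p - 2) * ‖Y‖ = ‖Y‖ ^ (p - 1) := by
    rw [← Real.rpow_add_one hY'.ne']; ring_nf
  have h2 : ‖Y‖ ^ (p - 1) * ‖Y‖ = ‖Y‖ ^ p := by
    rw [← Real.rpow_add_one hY'.ne']; ring_nf
  have h3 : α * ⟪Y, X⟫_ℝ ≤ p * t ^ (p - 1) * (‖Y‖ * ‖X‖) := by
    calc α * ⟪Y, X⟫_ℝ ≤ |α| * |⟪Y, X⟫_ℝ| := by rw [← abs_mul]; exact le_abs_self _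
      _ ≤ _ := mul_le_mul hα (abs_real_inner_le_norm Y X) (abs_nonneg _) (by positivity)
  have hyoung := young_rpow_sub_one hp (mul_nonneg ht hY'.le) (norm_nonneg X)
  rw [Real.mul_rpow ht hY'.le, Real.mul_rpow ht hY'.le] at hyoung
  calc ‖Y‖ ^ (p - 2) * ⟪Y, α • X + β • Y⟫_ℝ
      = ‖Y‖ ^ (p - 2) * (α * ⟪Y, X⟫_ℝ) + β * (‖Y‖ ^ (p - 2) * ‖Y‖ * ‖Y‖) := by
        rw [inner_add_right, inner_smul_right, inner_smul_right, real_inner_self_eq_norm_sq]; ring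
    _ ≤ ‖Y‖ ^ (p - 2) * (p * t ^ (p - 1) * (‖Y‖ * ‖X‖)) + β * (‖Y‖ ^ (p - 2) * ‖Y‖ * ‖Y‖) := by
        gcongr
    _ = p * (t ^ (p - 1) * (‖Y‖ ^ (p - 2) * ‖Y‖)) * ‖X‖ + β * (‖Y‖ ^ (p - 2) * ‖Y‖ * ‖Y‖) := by
        ring
    _ = p * (t ^ (p - 1) * ‖Y‖ ^ (p - 1)) * ‖X‖ - (p - 1) * (t ^ p * ‖Y‖ ^ p) := by
        rw [h1, h2, hβ]; ring
    _ ≤ ‖X‖ ^ p := by linarith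

/-- The case `d < c` of the discrete Picone inequality: convexity of `t ↦ t ^ p` at
`|a - b| + b = θ (|a - b| / θ) + (1 - θ) (b / (1 - θ))`, where `θ = (c - d) / c`. -/
theorem picone_discrete_of_lt {p a b c d : ℝ} (hp : 1 < p) (ha : 0 ≤ a) (hb : 0 ≤ b)
    (hd : 0 < d) (hdc : d < c) :
    (c - d) ^ (p - 1) * (a ^ p * c ^ (1 - p) - b ^ p * d ^ (1 - p)) ≤ |a - b| ^ p := by
  have hc : 0 < c := hd.trans hdc
  have hcd : 0 < c - d := sub_pos.2 hdc
  have hconv := (convexOn_rpow hp.le).2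
    (Set.mem_Ici.2 (by positivity : 0 ≤ |a - b| * c / (c - d)))
    (Set.mem_Ici.2 (by positivity : 0 ≤ b * c / d))
    (by positivity : 0 ≤ (c - d) / c) (by positivity : 0 ≤ d / c) (by field_simp; ring)
  have h1 : (c - d) / c * (|a - b| * c / (c - d)) + d / c * (b * c / d) = |a - b| + b := by
    field_simp
  simp only [smul_eq_mul] at hconv
  rw [h1] at hconv
  have h2 : a ^ p ≤ (|a - b| + b) ^ p :=
    Real.rpow_le_rpow ha (by linarith [le_abs_self (a - b)]) (by linarith)
  have key : ∀ x e : ℝ, 0 ≤ x → 0 < e →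
      e / c * (x * c / e) ^ p = x ^ p * (c ^ (p - 1) * e ^ (1 - p)) := by
    intro x e hx he
    rw [Real.div_rpow (by positivity) he.le, Real.mul_rpow hx hc.le, Real.rpow_sub_one hc.ne',
      Real.rpow_sub he, Real.rpow_one]
    have := (Real.rpow_pos_of_pos he p).ne'
    field_simp
  rw [key _ _ (abs_nonneg _) hcd, key _ _ hb hd] at hconv
  have h3 : (c - d) ^ (p - 1) * (c - d) ^ (1 - p) = 1 := by
    rw [← Real.rpow_add hcd]; simp
  have h4 : c ^ (p - 1) * c ^ (1 - p) = 1 := by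
    rw [← Real.rpow_add hc]; simp
  have h5 : 0 < (c - d) ^ (p - 1) * c ^ (1 - p) := by positivity
  have h6 := mul_le_mul_of_nonneg_left (h2.trans hconv) h5.le
  have h7 : (c - d) ^ (p - 1) * c ^ (1 - p) *
      (|a - b| ^ p * (c ^ (p - 1) * (c - d) ^ (1 - p)) + b ^ p * (c ^ (p - 1) * d ^ (1 - p)))
      = ((c - d) ^ (p - 1) * (c - d) ^ (1 - p)) * (c ^ (p - 1) * c ^ (1 - p)) * |a - b| ^ p
        + (c ^ (p - 1) * c ^ (1 - p)) * ((c - d) ^ (p - 1) * (b ^ p * d ^ (1 - p))) := by ring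
  rw [h7, h3, h4] at h6
  linarith

/-- The discrete Picone inequality. -/
theorem picone_discrete {p a b c d : ℝ} (hp : 1 < p) (ha : 0 ≤ a) (hb : 0 ≤ b)
    (hc : 0 < c) (hd : 0 < d) :
    |c - d| ^ (p - 2) * (c - d) * (a ^ p * c ^ (1 - p) - b ^ p * d ^ (1 - p)) ≤ |a - b| ^ p := by
  have hpow : ∀ x : ℝ, 0 < x → x ^ (p - 2) * x = x ^ (p - 1) := fun x hx => by
    rw [← Real.rpow_add_one hx.ne']; ring_nf
  rcases lt_trichotomy d c with h | h | h
  · rw [abs_of_pos (sub_pos.2 h), hpow _ (sub_pos.2 h)]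
    exact picone_discrete_of_lt hp ha hb hd h
  · simp only [h, sub_self, mul_zero, zero_mul]; positivity
  · have := picone_discrete_of_lt hp hb ha hc h
    rw [← hpow _ (sub_pos.2 h)] at this
    rw [abs_sub_comm c d, abs_of_pos (sub_pos.2 h), abs_sub_comm a b]
    linarith

/-! ### The profile of the test functions -/

/-- A bounded `C¹` substitute for `|t|^p`, tending to it as `ε → 0⁺`. It is the `p`-th power of a
contraction applied to `t`, so that it does not spoil Picone's inequality. -/
noncomputable def truncPow (p ε t : ℝ) : ℝ := |Real.arctan (ε * t) / ε| ^ p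

/-- A bounded `C¹` extension to the whole line of the function `t ↦ (t + ε)^(1 - p)` of
`t ≥ 0`, given by the primitive of an even function. -/
noncomputable def dampedPow (p ε t : ℝ) : ℝ :=
  ε ^ (1 - p) - ∫ τ in (0 : ℝ)..t, (p - 1) * (|τ| + ε) ^ (-p)

theorem hasDerivAt_arctan_mul_div {ε : ℝ} (hε : 0 < ε) (t : ℝ) :
    HasDerivAt (fun t => Real.arctan (ε * t) / ε) (1 / (1 + (ε * t) ^ 2)) t := by
  have h := (((hasDerivAt_id t).const_mul ε).arctan).div_const ε
  refine h.congr_deriv ?_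
  simp only [id]
  field_simp

theorem abs_one_div_one_add_sq_le (x : ℝ) : |1 / (1 + x ^ 2)| ≤ 1 := by
  rw [abs_of_pos (by positivity), div_le_one (by positivity)]
  nlinarith [sq_nonneg x]

theorem abs_arctan_mul_div_sub_le {ε : ℝ} (hε : 0 < ε) (s t : ℝ) :
    |Real.arctan (ε * s) / ε - Real.arctan (ε * t) / ε| ≤ |s - t| := by
  have := Convex.norm_image_sub_le_of_norm_hasDerivWithin_le (C := 1) (s := Set.univ)
    (f := fun t => Real.arctan (ε * t) / ε) (x := t) (y := s)
    (fun x _ => (hasDerivAt_arctan_mul_div hε x).hasDerivWithinAt)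
    (fun x _ => abs_one_div_one_add_sq_le _) convex_univ trivial trivial
  simpa using this

theorem abs_arctan_mul_div_le_abs {ε : ℝ} (hε : 0 < ε) (t : ℝ) :
    |Real.arctan (ε * t) / ε| ≤ |t| := by
  simpa using abs_arctan_mul_div_sub_le hε t 0

theorem abs_arctan_mul_div_le {ε : ℝ} (hε : 0 < ε) (t : ℝ) :
    |Real.arctan (ε * t) / ε| ≤ 2 / ε := by
  rw [abs_div, abs_of_pos hε]
  gcongr
  rw [abs_le]
  constructor <;> linarith [Real.arctan_lt_pi_div_two (ε * t),
    Real.neg_pi_div_two_lt_arctan (ε * t), Real.pi_le_four]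

theorem truncPow_nonneg (p ε t : ℝ) : 0 ≤ truncPow p ε t := by unfold truncPow; positivity

theorem truncPow_zero {p : ℝ} (hp : 1 < p) (ε : ℝ) : truncPow p ε 0 = 0 := by
  simp [truncPow, Real.zero_rpow (by linarith : p ≠ 0)]

theorem truncPow_le_abs_rpow {p ε : ℝ} (hp : 1 < p) (hε : 0 < ε) (t : ℝ) :
    truncPow p ε t ≤ |t| ^ p :=
  Real.rpow_le_rpow (abs_nonneg _) (abs_arctan_mul_div_le_abs hε t) (by linarith)

theorem truncPow_le {p ε : ℝ} (hp : 1 < p) (hε : 0 < ε) (t : ℝ) :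
    truncPow p ε t ≤ (2 / ε) ^ p :=
  Real.rpow_le_rpow (abs_nonneg _) (abs_arctan_mul_div_le hε t) (by linarith)

theorem tendsto_truncPow {p : ℝ} (hp : 1 < p) (t : ℝ) {ε : ℕ → ℝ} (hε : ∀ n, 0 < ε n)
    (h0 : Tendsto ε atTop (𝓝 0)) :
    Tendsto (fun n => truncPow p (ε n) t) atTop (𝓝 (|t| ^ p)) := by
  have hd : HasDerivAt (fun e => Real.arctan (e * t)) t 0 := by
    have := ((hasDerivAt_id (0 : ℝ)).mul_const t).arctan
    simpa using this
  have hs := hasDerivAt_iff_tendsto_slope.1 hd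
  have hε' : Tendsto ε atTop (𝓝[≠] 0) :=
    tendsto_nhdsWithin_iff.2 ⟨h0, Eventually.of_forall fun n => (hε n).ne'⟩
  have h1 : Tendsto (fun n => Real.arctan (ε n * t) / ε n) atTop (𝓝 t) := by
    refine (hs.comp hε').congr fun n => ?_
    simp [slope_def_field]
  exact (h1.abs).rpow_const (Or.inr (by linarith))

/-- The derivative of `truncPow p ε`. -/
noncomputable def truncPowDeriv (p ε t : ℝ) : ℝ :=
  p * |Real.arctan (ε * t) / ε| ^ (p - 2) * (Real.arctan (ε * t) / ε) * (1 / (1 + (ε * t) ^ 2))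

theorem hasDerivAt_truncPow {p ε : ℝ} (hp : 1 < p) (hε : 0 < ε) (t : ℝ) :
    HasDerivAt (truncPow p ε) (truncPowDeriv p ε t) t :=
  HasDerivAt.comp (h₂ := fun x => |x| ^ p) t (hasDerivAt_abs_rpow (Real.arctan (ε * t) / ε) hp)
    (hasDerivAt_arctan_mul_div hε t)

theorem continuous_truncPowDeriv {p ε : ℝ} (hp : 1 < p) (hε : 0 < ε) :
    Continuous (truncPowDeriv p ε) := by
  have hC : ContDiff ℝ 1 (truncPow p ε) :=
    (contDiff_norm_rpow (E := ℝ) hp).comp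
      ((Real.contDiff_arctan.comp (contDiff_const.mul contDiff_id)).div_const ε)
  have := hC.continuous_deriv le_rfl
  rwa [show deriv (truncPow p ε) = truncPowDeriv p ε from
    funext fun t => (hasDerivAt_truncPow hp hε t).deriv] at this

theorem abs_truncPowDeriv_le {p ε : ℝ} (hp : 1 < p) (t : ℝ) :
    |truncPowDeriv p ε t| ≤ p * |Real.arctan (ε * t) / ε| ^ (p - 1) := by
  unfold truncPowDeriv
  set g := Real.arctan (ε * t) / ε
  rw [abs_mul, abs_mul, abs_mul, abs_of_pos (by linarith : 0 < p),
    abs_of_nonneg (by positivity : 0 ≤ |g| ^ (p - 2)), mul_assoc p]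
  have h : |g| ^ (p - 2) * |g| = |g| ^ (p - 1) := by
    rcases eq_or_ne g 0 with h0 | h0
    · rw [h0, abs_zero, mul_zero, Real.zero_rpow (by linarith)]
    · rw [← Real.rpow_add_one (abs_ne_zero.2 h0)]; ring_nf
  rw [h]
  exact mul_le_of_le_one_right (by positivity) (abs_one_div_one_add_sq_le _)

theorem continuous_dampedPow_integrand (p : ℝ) {ε : ℝ} (hε : 0 < ε) :
    Continuous fun τ : ℝ => (p - 1) * (|τ| + ε) ^ (-p) := by
  refine continuous_const.mul (Continuous.rpow_const (by fun_prop) fun τ => Or.inl ?_)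
  positivity

theorem hasDerivAt_dampedPow (p : ℝ) {ε : ℝ} (hε : 0 < ε) (t : ℝ) :
    HasDerivAt (dampedPow p ε) (-((p - 1) * (|t| + ε) ^ (-p))) t :=
  ((continuous_dampedPow_integrand p hε).integral_hasStrictDerivAt 0 t).hasDerivAt.const_sub _

theorem dampedPow_of_nonneg {p ε t : ℝ} (hε : 0 < ε) (ht : 0 ≤ t) :
    dampedPow p ε t = (t + ε) ^ (1 - p) := by
  have h := intervalIntegral.integral_eq_sub_of_hasDerivAt (a := 0) (b := t)
    (f := fun τ => -(τ + ε) ^ (1 - p)) (f' := fun τ => (p - 1) * (|τ| + ε) ^ (-p)) ?_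
    ((continuous_dampedPow_integrand p hε).intervalIntegrable _ _)
  · rw [dampedPow, h]; simp
  · intro τ hτ
    rw [Set.uIcc_of_le ht] at hτ
    have h2 := (((hasDerivAt_id τ).add_const ε).rpow_const (p := 1 - p)
      (Or.inl (by simp only [id]; linarith [hτ.1]))).neg
    refine h2.congr_deriv ?_
    rw [abs_of_nonneg hτ.1, show 1 - p - 1 = -p by ring]
    simp only [id]
    ring

/-- Negative arguments are handled through the symmetry
`dampedPow p ε (-t) = 2 ε^(1-p) - dampedPow p ε t`. -/
theorem abs_dampedPow_le {p ε : ℝ} (hp : 1 < p) (hε : 0 < ε) (t : ℝ) :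
    |dampedPow p ε t| ≤ 2 * ε ^ (1 - p) := by
  have hpos : ∀ t, 0 ≤ t → 0 ≤ dampedPow p ε t ∧ dampedPow p ε t ≤ ε ^ (1 - p) := by
    intro t ht
    rw [dampedPow_of_nonneg hε ht]
    exact ⟨by positivity, Real.rpow_le_rpow_of_nonpos hε (by linarith) (by linarith)⟩
  have h0 : 0 ≤ ε ^ (1 - p) := by positivity
  rcases le_total 0 t with ht | ht
  · rw [abs_of_nonneg (hpos t ht).1]; linarith [hpos t ht]
  · have hsymm : dampedPow p ε t = 2 * ε ^ (1 - p) - dampedPow p ε (-t) := by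
      have h := intervalIntegral.integral_comp_neg (a := 0) (b := -t)
        (fun τ : ℝ => (p - 1) * (|τ| + ε) ^ (-p))
      simp only [abs_neg, neg_neg, neg_zero] at h
      rw [dampedPow, dampedPow, h, intervalIntegral.integral_symm 0 t]
      ring
    have := hpos (-t) (by linarith)
    rw [hsymm, abs_of_nonneg (by linarith)]
    linarith

/-! ### Functions of two variables acting on pairs of Sobolev functions -/

/-- `F : ℝ² → ℝ` vanishes at the origin and has the continuous partial derivatives `F₁`, `F₂`,
both bounded by `K`. -/
structure HasBoundedPartials (F F₁ F₂ : ℝ × ℝ → ℝ) (K : ℝ) : Prop where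
  zero : F 0 = 0
  hasFDerivAt : ∀ z, HasFDerivAt F
    (F₁ z • ContinuousLinearMap.fst ℝ ℝ ℝ + F₂ z • ContinuousLinearMap.snd ℝ ℝ ℝ) z
  continuous_fst : Continuous F₁
  continuous_snd : Continuous F₂
  abs_fst_le : ∀ z, |F₁ z| ≤ K
  abs_snd_le : ∀ z, |F₂ z| ≤ K

namespace HasBoundedPartials

variable {F F₁ F₂ : ℝ × ℝ → ℝ} {K : ℝ}

theorem nonneg (hF : HasBoundedPartials F F₁ F₂ K) : 0 ≤ K :=
  (abs_nonneg _).trans (hF.abs_fst_le 0)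

theorem continuous (hF : HasBoundedPartials F F₁ F₂ K) : Continuous F :=
  continuous_iff_continuousAt.2 fun z => (hF.hasFDerivAt z).continuousAt

theorem abs_sub_le (hF : HasBoundedPartials F F₁ F₂ K) (z w : ℝ × ℝ) :
    |F z - F w| ≤ 2 * K * (|z.1 - w.1| + |z.2 - w.2|) := by
  have h := Convex.norm_image_sub_le_of_norm_hasFDerivWithin_le (C := 2 * K) (s := Set.univ)
    (f := F) (x := w) (y := z) (fun x _ => (hF.hasFDerivAt x).hasFDerivWithinAt)
    (fun x _ => ?_) convex_univ trivial trivial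
  · refine h.trans ?_
    have hK := hF.nonneg
    gcongr
    rw [Prod.norm_def]
    exact max_le (le_add_of_nonneg_right (abs_nonneg _)) (le_add_of_nonneg_left (abs_nonneg _))
  · refine (norm_add_le _ _).trans ?_
    rw [norm_smul, norm_smul, two_mul]
    refine add_le_add ?_ ?_
    · exact (mul_le_of_le_one_right (norm_nonneg _) (ContinuousLinearMap.norm_fst_le ℝ ℝ ℝ)).trans
        (hF.abs_fst_le x)
    · exact (mul_le_of_le_one_right (norm_nonneg _) (ContinuousLinearMap.norm_snd_le ℝ ℝ ℝ)).trans
        (hF.abs_snd_le x)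

theorem abs_le (hF : HasBoundedPartials F F₁ F₂ K) (z : ℝ × ℝ) :
    |F z| ≤ 2 * K * (|z.1| + |z.2|) := by
  simpa [hF.zero] using hF.abs_sub_le z 0

end HasBoundedPartials

theorem hasBoundedPartials_const_mul_fst (c : ℝ) :
    HasBoundedPartials (fun z => c * z.1) (fun _ => c) (fun _ => 0) |c| where
  zero := by simp
  hasFDerivAt z := by
    simpa using (hasFDerivAt_fst (𝕜 := ℝ) (p := z)).const_mul c
  continuous_fst := continuous_const
  continuous_snd := continuous_const
  abs_fst_le _ := le_rfl
  abs_snd_le _ := by simp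

/-- The function `(s, t) ↦ |s|^p / t^(p-1)` of the Picone identity, regularized: applied to
`(u, v)` it gives the test function by which the equation for `v` is compared with `u`. -/
noncomputable def piconeProfile (p ε : ℝ) (z : ℝ × ℝ) : ℝ := truncPow p ε z.1 * dampedPow p ε z.2

theorem hasBoundedPartials_piconeProfile {p ε : ℝ} (hp : 1 < p) (hε : 0 < ε) :
    ∃ K, HasBoundedPartials (piconeProfile p ε)
      (fun z => truncPowDeriv p ε z.1 * dampedPow p ε z.2)
      (fun z => truncPow p ε z.1 * -((p - 1) * (|z.2| + ε) ^ (-p))) K := by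
  have hH : Continuous (dampedPow p ε) :=
    continuous_iff_continuousAt.2 fun t => (hasDerivAt_dampedPow p hε t).continuousAt
  have hG : Continuous (truncPow p ε) :=
    continuous_iff_continuousAt.2 fun t => (hasDerivAt_truncPow hp hε t).continuousAt
  refine ⟨max (p * (2 / ε) ^ (p - 1) * (2 * ε ^ (1 - p))) ((2 / ε) ^ p * ((p - 1) * ε ^ (-p))),
    ?_, fun z => ?_, ?_, ?_, fun z => ?_, fun z => ?_⟩
  · simp [piconeProfile, truncPow_zero hp]
  · have h1 := (hasDerivAt_truncPow hp hε z.1).comp_hasFDerivAt z (hasFDerivAt_fst (𝕜 := ℝ))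
    have h2 := (hasDerivAt_dampedPow p hε z.2).comp_hasFDerivAt z (hasFDerivAt_snd (𝕜 := ℝ))
    have h3 := h1.mul h2
    refine h3.congr_fderiv ?_
    ext <;> simp [mul_comm]
  · exact ((continuous_truncPowDeriv hp hε).comp continuous_fst).mul (hH.comp continuous_snd)
  · exact (hG.comp continuous_fst).mul
      ((continuous_dampedPow_integrand p hε).neg.comp continuous_snd)
  · refine le_max_of_le_left ?_
    rw [abs_mul]
    refine mul_le_mul ((abs_truncPowDeriv_le hp _).trans ?_) (abs_dampedPow_le hp hε _)
      (abs_nonneg _) (by positivity)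
    exact mul_le_mul_of_nonneg_left
      (Real.rpow_le_rpow (abs_nonneg _) (abs_arctan_mul_div_le hε _) (by linarith)) (by linarith)
  · refine le_max_of_le_right ?_
    have hp1 : 0 < p - 1 := by linarith
    rw [abs_mul, abs_neg, abs_of_nonneg (truncPow_nonneg _ _ _), abs_of_nonneg (by positivity)]
    refine mul_le_mul (truncPow_le hp hε _) (mul_le_mul_of_nonneg_left ?_ hp1.le)
      (by positivity) (by positivity)
    exact Real.rpow_le_rpow_of_nonpos hε (by linarith [abs_nonneg z.2]) (by linarith)

/-! ### The fractional space -/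

section Fractional

variable {N : ℕ} {Ω : Set (Eucl N)} {s p : ℝ} {u v : Eucl N → ℝ}

theorem add_rpow_le_two_rpow_mul {p a b : ℝ} (hp : 0 ≤ p) (ha : 0 ≤ a) (hb : 0 ≤ b) :
    (a + b) ^ p ≤ 2 ^ p * (a ^ p + b ^ p) := by
  have h : (a + b) ^ p ≤ (2 * max a b) ^ p :=
    Real.rpow_le_rpow (by positivity) (by linarith [le_max_left a b, le_max_right a b]) hp
  refine h.trans ?_
  rw [Real.mul_rpow (by norm_num) (le_max_of_le_left ha)]
  gcongr
  rcases max_choice a b with h | h <;> rw [h]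
  · linarith [Real.rpow_nonneg hb p]
  · linarith [Real.rpow_nonneg ha p]

theorem gagliardoIntegrand_nonneg (s p : ℝ) (u : Eucl N → ℝ) (z : Eucl N × Eucl N) :
    0 ≤ gagliardoIntegrand s p u z := by unfold gagliardoIntegrand; positivity

theorem ae_prod_of_ae {P : Eucl N → Prop} (h : ∀ᵐ x, P x) :
    ∀ᵐ z : Eucl N × Eucl N, P z.1 ∧ P z.2 :=
  (Measure.quasiMeasurePreserving_fst.ae h).and (Measure.quasiMeasurePreserving_snd.ae h)

theorem aestronglyMeasurable_gagliardoIntegrand (s p : ℝ) (hu : AEStronglyMeasurable u volume) :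
    AEStronglyMeasurable (gagliardoIntegrand s p u) volume := by
  have h1 : AEMeasurable (fun z : Eucl N × Eucl N => u z.1) volume :=
    (hu.comp_quasiMeasurePreserving Measure.quasiMeasurePreserving_fst).aemeasurable
  have h2 : AEMeasurable (fun z : Eucl N × Eucl N => u z.2) volume :=
    (hu.comp_quasiMeasurePreserving Measure.quasiMeasurePreserving_snd).aemeasurable
  have h3 : Measurable fun z : Eucl N × Eucl N => ‖z.1 - z.2‖ ^ ((N : ℝ) + s * p) :=
    ((measurable_fst.sub measurable_snd).norm).pow_const _
  have h4 : AEMeasurable (fun z : Eucl N × Eucl N => |u z.1 - u z.2| ^ p) volume :=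
    ((h1.sub h2).norm).pow_const p
  exact (h4.div h3.aemeasurable).aestronglyMeasurable

theorem gagliardoIntegrand_comp_le (hp : 0 ≤ p) {F F₁ F₂ : ℝ × ℝ → ℝ} {K : ℝ}
    (hF : HasBoundedPartials F F₁ F₂ K) (z : Eucl N × Eucl N) :
    gagliardoIntegrand s p (fun x => F (u x, v x)) z ≤
      (2 * K) ^ p * 2 ^ p * (gagliardoIntegrand s p u z + gagliardoIntegrand s p v z) := by
  have hK := hF.nonneg
  unfold gagliardoIntegrand
  rw [← add_div, ← mul_div_assoc]
  refine div_le_div_of_nonneg_right ?_ (by positivity)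
  calc |F (u z.1, v z.1) - F (u z.2, v z.2)| ^ p
      ≤ (2 * K * (|u z.1 - u z.2| + |v z.1 - v z.2|)) ^ p :=
        Real.rpow_le_rpow (abs_nonneg _) (hF.abs_sub_le _ _) hp
    _ = (2 * K) ^ p * (|u z.1 - u z.2| + |v z.1 - v z.2|) ^ p :=
        Real.mul_rpow (by positivity) (by positivity)
    _ ≤ (2 * K) ^ p * (2 ^ p * (|u z.1 - u z.2| ^ p + |v z.1 - v z.2| ^ p)) := by
        gcongr
        exact add_rpow_le_two_rpow_mul hp (abs_nonneg _) (abs_nonneg _)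
    _ = _ := by ring

theorem memLp_comp {α : Type*} [MeasurableSpace α] {μ : Measure α} {q : ℝ≥0∞} {u v : α → ℝ}
    {F F₁ F₂ : ℝ × ℝ → ℝ} {K : ℝ} (hF : HasBoundedPartials F F₁ F₂ K)
    (hu : MemLp u q μ) (hv : MemLp v q μ) : MemLp (fun x => F (u x, v x)) q μ := by
  refine ((hu.norm.add hv.norm).const_mul (2 * K)).mono
    (hF.continuous.comp_aestronglyMeasurable (hu.1.prodMk hv.1)) (Eventually.of_forall fun x => ?_)
  exact (hF.abs_le (u x, v x)).trans (le_abs_self _)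

theorem MemFracSobolevZero.comp (hp : 0 ≤ p) {F F₁ F₂ : ℝ × ℝ → ℝ} {K : ℝ}
    (hF : HasBoundedPartials F F₁ F₂ K) (hu : MemFracSobolevZero Ω s p u)
    (hv : MemFracSobolevZero Ω s p v) :
    MemFracSobolevZero Ω s p (fun x => F (u x, v x)) := by
  have hL := memLp_comp hF hu.1.1 hv.1.1
  refine ⟨⟨hL, ?_⟩, ?_⟩
  · refine ((hu.1.2.add hv.1.2).const_mul ((2 * K) ^ p * 2 ^ p)).mono'
      (aestronglyMeasurable_gagliardoIntegrand s p hL.1) (Eventually.of_forall fun z => ?_)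
    rw [Real.norm_of_nonneg (gagliardoIntegrand_nonneg _ _ _ _)]
    exact gagliardoIntegrand_comp_le hp hF z
  · filter_upwards [hu.2, hv.2] with x h1 h2 hx
    rw [h1 hx, h2 hx]
    exact hF.zero

theorem normW0_rpow_of_ne_one (hs : s ≠ 1) (hp : 0 < p) (u : Eucl N → ℝ) :
    normW0 Ω s p u ^ p = ∫ z : Eucl N × Eucl N, gagliardoIntegrand s p u z := by
  rw [normW0, if_neg hs, ← Real.rpow_mul (integral_nonneg (gagliardoIntegrand_nonneg s p u)),
    one_div_mul_cancel hp.ne', Real.rpow_one]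

theorem abs_rpow_sub_two_mul_self_mul_self {p : ℝ} (hp : 0 < p) (t : ℝ) :
    |t| ^ (p - 2) * t * t = |t| ^ p := by
  rcases eq_or_ne t 0 with rfl | ht
  · simp [Real.zero_rpow hp.ne']
  · rw [mul_assoc, ← abs_mul_abs_self, ← mul_assoc, ← Real.rpow_add_one (abs_ne_zero.2 ht),
      ← Real.rpow_add_one (abs_ne_zero.2 ht)]
    ring_nf

theorem formA_self_of_ne_one (hs : s ≠ 1) (hp : 0 < p) (v : Eucl N → ℝ) :
    formA Ω s p v v = normW0 Ω s p v ^ p := by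
  rw [normW0_rpow_of_ne_one hs hp, formA, if_neg hs]
  refine integral_congr_ae (Eventually.of_forall fun z => ?_)
  simp only [gagliardoIntegrand, abs_rpow_sub_two_mul_self_mul_self hp]

theorem normW0_const_mul_of_ne_one (hs : s ≠ 1) (hp : 0 < p) {c : ℝ} (hc : 0 ≤ c)
    (v : Eucl N → ℝ) :
    normW0 Ω s p (fun x => c * v x) ^ p = c ^ p * normW0 Ω s p v ^ p := by
  rw [normW0_rpow_of_ne_one hs hp, normW0_rpow_of_ne_one hs hp, ← integral_const_mul]
  refine integral_congr_ae (Eventually.of_forall fun z => ?_)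
  simp only [gagliardoIntegrand]
  rw [← mul_sub, abs_mul, abs_of_nonneg hc, Real.mul_rpow hc (abs_nonneg _), mul_div_assoc]

/-- No integrability of `f` is needed: otherwise its Bochner integral is `0`. -/
theorem integral_le_integral_of_nonneg_right {α : Type*} [MeasurableSpace α] {μ : Measure α}
    {f g : α → ℝ} (hg : Integrable g μ) (hg0 : 0 ≤ g) (hfg : f ≤ᵐ[μ] g) :
    ∫ x, f x ∂μ ≤ ∫ x, g x ∂μ := by
  by_cases hf : Integrable f μ
  · exact integral_mono_ae hf hg hfg
  · rw [integral_undef hf]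
    exact integral_nonneg hg0

theorem formA_piconeProfile_le_of_ne_one (hs : s ≠ 1) (hp : 1 < p)
    (hu : MemFracSobolevZero Ω s p u) (hv0 : ∀ᵐ x, 0 ≤ v x) {ε : ℝ} (hε : 0 < ε) :
    formA Ω s p v (fun x => piconeProfile p ε (u x, v x)) ≤ normW0 Ω s p u ^ p := by
  rw [normW0_rpow_of_ne_one hs (by linarith), formA, if_neg hs]
  refine integral_le_integral_of_nonneg_right hu.1.2 (gagliardoIntegrand_nonneg s p u) ?_
  filter_upwards [ae_prod_of_ae hv0] with z hz
  refine div_le_div_of_nonneg_right ?_ (by positivity)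
  simp only [piconeProfile, dampedPow_of_nonneg hε hz.1, dampedPow_of_nonneg hε hz.2]
  have h := picone_discrete hp (abs_nonneg (Real.arctan (ε * u z.1) / ε))
    (abs_nonneg (Real.arctan (ε * u z.2) / ε)) (add_pos_of_nonneg_of_pos hz.1 hε)
    (add_pos_of_nonneg_of_pos hz.2 hε)
  rw [add_sub_add_right_eq_sub] at h
  refine h.trans (Real.rpow_le_rpow (abs_nonneg _) ?_ (by linarith))
  exact (abs_abs_sub_abs_le_abs_sub _ _).trans (abs_arctan_mul_div_sub_le hε _ _)

end Fractional

/-! ### Convergence in `L^q` -/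

section Convergence

variable {α E : Type*} [MeasurableSpace α] {μ : Measure α} [NormedAddCommGroup E]
  {q : ℝ≥0∞}

/-- Dominated convergence in `L^q`. -/
theorem tendsto_eLpNorm_zero_of_dominated (hq0 : q ≠ 0) (hq : q ≠ ⊤) {f : ℕ → α → E} {g : α → ℝ}
    (hf : ∀ n, AEStronglyMeasurable (f n) μ) (hg : MemLp g q μ)
    (hfg : ∀ n, ∀ᵐ x ∂μ, ‖f n x‖ ≤ g x) (hlim : ∀ᵐ x ∂μ, Tendsto (fun n => f n x) atTop (𝓝 0)) :
    Tendsto (fun n => eLpNorm (f n) q μ) atTop (𝓝 0) := by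
  have hpos : 0 < q.toReal := ENNReal.toReal_pos hq0 hq
  have h1 : Tendsto (fun n => ∫⁻ x, ‖f n x‖ₑ ^ q.toReal ∂μ) atTop (𝓝 (∫⁻ _, 0 ∂μ)) := by
    refine tendsto_lintegral_of_dominated_convergence' (fun x => ‖g x‖ₑ ^ q.toReal)
      (fun n => (hf n).enorm.pow_const _) (fun n => ?_)
      (lintegral_rpow_enorm_lt_top_of_eLpNorm_lt_top hq0 hq hg.2).ne ?_
    · filter_upwards [hfg n] with x hx
      refine ENNReal.rpow_le_rpow ?_ hpos.le
      exact enorm_le_iff_norm_le.2 (hx.trans (le_abs_self _))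
    · filter_upwards [hlim] with x hx
      have h := (hx.enorm).ennrpow_const q.toReal
      simpa [ENNReal.zero_rpow_of_pos hpos] using h
  have h2 := h1.ennrpow_const (1 / q.toReal)
  simp only [lintegral_zero, ENNReal.zero_rpow_of_pos (one_div_pos.2 hpos)] at h2
  simpa only [eLpNorm_eq_lintegral_rpow_enorm_toReal hq0 hq] using h2

theorem tendsto_eLpNorm_smul_sub_smul [NormedSpace ℝ E] (hq1 : 1 ≤ q) (hq : q ≠ ⊤) {K : ℝ}
    {c : ℕ → α → ℝ} {d : α → ℝ} {G : ℕ → α → E} {g : α → E} (hcm : ∀ n, AEStronglyMeasurable (c n) μ)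
    (hdm : AEStronglyMeasurable d μ) (hc : ∀ n x, |c n x| ≤ K) (hd : ∀ x, |d x| ≤ K)
    (hcd : ∀ᵐ x ∂μ, Tendsto (fun n => c n x) atTop (𝓝 (d x)))
    (hG : ∀ n, AEStronglyMeasurable (G n) μ) (hg : MemLp g q μ)
    (hGg : Tendsto (fun n => eLpNorm (fun x => G n x - g x) q μ) atTop (𝓝 0)) :
    Tendsto (fun n => eLpNorm (fun x => c n x • G n x - d x • g x) q μ) atTop (𝓝 0) := by
  have h1 : Tendsto (fun n => eLpNorm (fun x => (c n x - d x) • g x) q μ) atTop (𝓝 0) := by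
    refine tendsto_eLpNorm_zero_of_dominated (zero_lt_one.trans_le hq1).ne' hq
      (fun n => ((hcm n).sub hdm).smul hg.1) (hg.norm.const_mul (K + K))
      (fun n => Eventually.of_forall fun x => ?_) ?_
    · rw [norm_smul]
      refine mul_le_mul_of_nonneg_right ?_ (norm_nonneg _)
      exact (abs_sub _ _).trans (add_le_add (hc n x) (hd x))
    · filter_upwards [hcd] with x hx
      simpa using (hx.sub_const (d x)).smul_const (g x)
  have h2 : Tendsto (fun n => ENNReal.ofReal K * eLpNorm (fun x => G n x - g x) q μ) atTop
      (𝓝 0) := by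
    simpa using ENNReal.Tendsto.const_mul hGg (Or.inr ENNReal.ofReal_ne_top)
  refine tendsto_of_tendsto_of_tendsto_of_le_of_le tendsto_const_nhds (by simpa using h2.add h1)
    (fun n => zero_le) fun n => ?_
  have hsplit : (fun x => c n x • G n x - d x • g x)
      = (fun x => c n x • (G n x - g x)) + fun x => (c n x - d x) • g x := by
    ext x; simp only [Pi.add_apply, smul_sub, sub_smul]; abel
  rw [hsplit]
  refine (eLpNorm_add_le ((hcm n).smul ((hG n).sub hg.1)) (((hcm n).sub hdm).smul hg.1)
    hq1).trans (add_le_add_left ?_ _)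
  refine eLpNorm_le_mul_eLpNorm_of_ae_le_mul (Eventually.of_forall fun x => ?_) q
  exact (norm_smul _ _).trans_le (mul_le_mul_of_nonneg_right (hc n x) (norm_nonneg _))

/-- On a finite measure space, convergence in `L^q` and a pointwise Lipschitz bound give
convergence of integrals. -/
theorem tendsto_integral_of_tendsto_eLpNorm {H : Type*} [NormedAddCommGroup H]
    [NormedSpace ℝ H] [IsFiniteMeasure μ] (hq1 : 1 ≤ q) {f : ℕ → α → E} {g : α → E}
    (hfg : Tendsto (fun n => eLpNorm (fun x => f n x - g x) q μ) atTop (𝓝 0))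
    (hm : ∀ n, AEStronglyMeasurable (fun x => f n x - g x) μ)
    {Φ : ℕ → α → H} {Ψ : α → H} (hΦ : ∀ n, Integrable (Φ n) μ) (hΨ : AEStronglyMeasurable Ψ μ)
    {C : ℝ} (hC : ∀ n x, ‖Φ n x - Ψ x‖ ≤ C * ‖f n x - g x‖) :
    Tendsto (fun n => ∫ x, Φ n x ∂μ) atTop (𝓝 (∫ x, Ψ x ∂μ)) := by
  refine tendsto_integral_of_L1' Ψ hΨ (Eventually.of_forall hΦ) ?_
  set D : ℝ≥0∞ := ENNReal.ofReal C * μ Set.univ ^ (1 / (1 : ℝ≥0∞).toReal - 1 / q.toReal)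
  have hD : D ≠ ⊤ := by
    refine ENNReal.mul_ne_top ENNReal.ofReal_ne_top (ENNReal.rpow_ne_top_of_nonneg ?_
      (measure_ne_top _ _))
    rcases eq_or_ne q ⊤ with rfl | hq
    · simp
    · have : 1 ≤ q.toReal := by simpa using ENNReal.toReal_mono hq hq1
      simp only [ENNReal.toReal_one, div_one, sub_nonneg, one_div]
      exact inv_le_one_of_one_le₀ this
  have h2 : Tendsto (fun n => D * eLpNorm (fun x => f n x - g x) q μ) atTop (𝓝 0) := by
    simpa using ENNReal.Tendsto.const_mul hfg (Or.inr hD)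
  refine tendsto_of_tendsto_of_tendsto_of_le_of_le tendsto_const_nhds h2 (fun n => zero_le)
    fun n => ?_
  calc eLpNorm (Φ n - Ψ) 1 μ ≤ ENNReal.ofReal C * eLpNorm (fun x => f n x - g x) 1 μ :=
        eLpNorm_le_mul_eLpNorm_of_ae_le_mul (Eventually.of_forall fun x => hC n x) 1
    _ ≤ ENNReal.ofReal C * (eLpNorm (fun x => f n x - g x) q μ *
          μ Set.univ ^ (1 / (1 : ℝ≥0∞).toReal - 1 / q.toReal)) := by
        gcongr
        exact eLpNorm_le_eLpNorm_mul_rpow_measure_univ hq1 (hm n)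
    _ = D * eLpNorm (fun x => f n x - g x) q μ := by simp only [D]; ring

end Convergence

/-! ### Gradients of smooth functions -/

section Gradient

variable {N : ℕ} {Ω : Set (Eucl N)}

theorem gradient_eq_toDual_symm (f : Eucl N → ℝ) (x : Eucl N) :
    gradient f x = (InnerProductSpace.toDual ℝ (Eucl N)).symm (fderiv ℝ f x) := rfl

theorem norm_gradient_sub_gradient (f g : Eucl N → ℝ) (x : Eucl N) :
    ‖gradient f x - gradient g x‖ = ‖fderiv ℝ f x - fderiv ℝ g x‖ := by
  rw [gradient_eq_toDual_symm, gradient_eq_toDual_symm, ← map_sub, LinearIsometryEquiv.norm_map]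

theorem continuous_gradient {f : Eucl N → ℝ} (hf : ContDiff ℝ 1 f) : Continuous (gradient f) :=
  (InnerProductSpace.toDual ℝ (Eucl N)).symm.continuous.comp (hf.continuous_fderiv one_ne_zero)

theorem tsupport_gradient_subset (f : Eucl N → ℝ) : tsupport (gradient f) ⊆ tsupport f :=
  (tsupport_comp_subset (g := (InnerProductSpace.toDual ℝ (Eucl N)).symm) (map_zero _)
    (fderiv ℝ f)).trans (tsupport_fderiv_subset ℝ)

theorem hasCompactSupport_gradient {f : Eucl N → ℝ} (hf : HasCompactSupport f) :
    HasCompactSupport (gradient f) :=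
  hf.of_isClosed_subset (isClosed_tsupport _) (tsupport_gradient_subset f)

theorem integrable_smul_of_tsupport_subset {V : Type*} [NormedAddCommGroup V] [NormedSpace ℝ V]
    {φ : Eucl N → ℝ} (hφ : Continuous φ) (hc : HasCompactSupport φ) (hsub : tsupport φ ⊆ Ω)
    {g : Eucl N → V} (hg : LocallyIntegrableOn g Ω volume) :
    Integrable (fun x => φ x • g x) volume := by
  have h := (hg.integrableOn_compact_subset hsub hc).continuousOn_smul hφ.continuousOn hc
  refine (integrableOn_iff_integrable_of_support_subset ?_).1 h
  exact (Function.support_smul_subset_left φ g).trans (subset_tsupport φ)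

theorem setIntegral_smul_eq_integral {V : Type*} [NormedAddCommGroup V] [NormedSpace ℝ V]
    {φ : Eucl N → ℝ} (hsub : tsupport φ ⊆ Ω) (g : Eucl N → V) :
    ∫ x in Ω, φ x • g x = ∫ x, φ x • g x := by
  refine setIntegral_eq_integral_of_forall_compl_eq_zero fun x hx => ?_
  rw [image_eq_zero_of_notMem_tsupport (fun h => hx (hsub h)), zero_smul]

/-- The weak gradient is unique. -/
theorem weakGradient_ae_eq (hΩ : IsOpen Ω) {u : Eucl N → ℝ} {g : Eucl N → Eucl N}
    (hg : IsWeakGradient Ω u g) : weakGradient Ω u =ᵐ[volume.restrict Ω] g := by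
  have hex : ∃ g, IsWeakGradient Ω u g := ⟨g, hg⟩
  have hw : IsWeakGradient Ω u (weakGradient Ω u) := by
    rw [weakGradient, dif_pos hex]; exact hex.choose_spec
  have h := hΩ.ae_eq_zero_of_integral_contDiff_smul_eq_zero (μ := volume)
    (hw.2.1.sub hg.2.1) fun φ h1 h2 h3 => ?_
  · rw [Filter.EventuallyEq, ae_restrict_iff' hΩ.measurableSet]
    filter_upwards [h] with x hx hxΩ
    exact sub_eq_zero.1 (hx hxΩ)
  · have e : ∫ x in Ω, φ x • weakGradient Ω u x = ∫ x in Ω, φ x • g x :=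
      neg_injective ((hw.2.2 φ ⟨h1, h2, h3⟩).symm.trans (hg.2.2 φ ⟨h1, h2, h3⟩))
    rw [setIntegral_smul_eq_integral h3, setIntegral_smul_eq_integral h3] at e
    simp only [Pi.sub_apply, smul_sub]
    rw [integral_sub (integrable_smul_of_tsupport_subset h1.continuous h2 h3 hw.2.1)
      (integrable_smul_of_tsupport_subset h1.continuous h2 h3 hg.2.1), e, sub_self]

theorem integral_smul_gradient_eq_neg {f χ : Eucl N → ℝ} (hf : ContDiff ℝ 1 f)
    (hχ : ContDiff ℝ 1 χ) (hχc : HasCompactSupport χ) :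
    ∫ x, f x • gradient χ x = -∫ x, χ x • gradient f x := by
  have i1 : Integrable (fun x => f x • gradient χ x) :=
    (hf.continuous.smul (continuous_gradient hχ)).integrable_of_hasCompactSupport
      (hasCompactSupport_gradient hχc).smul_left
  have i2 : Integrable (fun x => χ x • gradient f x) :=
    (hχ.continuous.smul (continuous_gradient hf)).integrable_of_hasCompactSupport hχc.smul_right
  refine ext_inner_left ℝ fun w => ?_
  rw [inner_neg_right, ← integral_inner i1, ← integral_inner i2]
  have hw : ∀ (k : Eucl N → ℝ) x, ⟪w, gradient k x⟫_ℝ = fderiv ℝ k x w := fun k x => by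
    rw [real_inner_comm, inner_gradient_left]
  simp only [inner_smul_right, hw]
  have hcf : Continuous fun x => fderiv ℝ f x w :=
    (hf.continuous_fderiv one_ne_zero).clm_apply continuous_const
  have hcχ : Continuous fun x => fderiv ℝ χ x w :=
    (hχ.continuous_fderiv one_ne_zero).clm_apply continuous_const
  rw [integral_mul_fderiv_eq_neg_fderiv_mul_of_integrable
    ((hcf.mul hχ.continuous).integrable_of_hasCompactSupport hχc.mul_left)
    ((hf.continuous.mul hcχ).integrable_of_hasCompactSupport (hχc.fderiv_apply ℝ w).mul_left)
    ((hf.continuous.mul hχ.continuous).integrable_of_hasCompactSupport hχc.mul_left)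
    (fun x _ => (hf.differentiable one_ne_zero) x) (fun x _ => (hχ.differentiable one_ne_zero) x)]
  simp only [mul_comm]

/-- Mollification: a compactly supported `C¹` function in `Ω` is a uniform limit of test functions,
together with its gradient. -/
theorem exists_isTestFunction_approx (hΩ : IsOpen Ω) {f : Eucl N → ℝ} (hf : ContDiff ℝ 1 f)
    (hfc : HasCompactSupport f) (hfΩ : tsupport f ⊆ Ω) {δ : ℝ} (hδ : 0 < δ) :
    ∃ φ, IsTestFunction Ω φ ∧ (∀ x, ‖φ x - f x‖ ≤ δ) ∧
      ∀ x, ‖gradient φ x - gradient f x‖ ≤ δ := by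
  have hcd : Continuous (fderiv ℝ f) := hf.continuous_fderiv one_ne_zero
  obtain ⟨r₁, hr₁, h₁⟩ := Metric.uniformContinuous_iff.1
    (hfc.uniformContinuous_of_continuous hf.continuous) δ hδ
  obtain ⟨r₂, hr₂, h₂⟩ := Metric.uniformContinuous_iff.1
    ((hfc.fderiv ℝ).uniformContinuous_of_continuous hcd) δ hδ
  obtain ⟨r₃, hr₃, h₃⟩ := hfc.isCompact.exists_cthickening_subset_open hΩ hfΩ
  -- The mollification radius: small oscillation of `f` and `∇f`, and support inside `Ω`.
  set r := min r₁ (min r₂ r₃)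
  have hr : 0 < r := lt_min hr₁ (lt_min hr₂ hr₃)
  let ρ : ContDiffBump (0 : Eucl N) := ⟨r / 2, r, by positivity, by linarith⟩
  have hloc : LocallyIntegrable f volume := hf.continuous.locallyIntegrable
  have hlocρ : LocallyIntegrable (ρ.normed volume) volume := ρ.continuous_normed.locallyIntegrable
  set φ := convolution (ρ.normed volume) f (ContinuousLinearMap.lsmul ℝ ℝ) volume with hφ
  have hsupp : Function.support φ ⊆ Metric.cthickening r₃ (tsupport f) := by
    refine (support_convolution_subset _).trans ?_
    rintro _ ⟨a, ha, b, hb, rfl⟩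
    rw [ρ.support_normed_eq] at ha
    refine Metric.mem_cthickening_of_dist_le _ b _ _ (subset_tsupport f hb) ?_
    rw [dist_eq_norm, add_sub_cancel_right]
    exact (mem_ball_zero_iff.1 ha).le.trans ((min_le_right _ _).trans (min_le_right _ _))
  have hφc : HasCompactSupport φ :=
    HasCompactSupport.of_support_subset_isCompact hfc.isCompact.cthickening hsupp
  refine ⟨φ, ⟨?_, hφc, ?_⟩, fun x => ?_, fun x => ?_⟩
  · exact ρ.hasCompactSupport_normed.contDiff_convolution_left _ ρ.contDiff_normed hloc
  · exact (closure_minimal hsupp Metric.isClosed_cthickening).trans h₃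
  · rw [← dist_eq_norm]
    refine ContDiffBump.dist_normed_convolution_le hf.continuous.aestronglyMeasurable
      fun y hy => (h₁ ?_).le
    exact (Metric.mem_ball.1 hy).trans_le (min_le_left _ _)
  · have hd : HasFDerivAt φ (convolution (ρ.normed volume) (fderiv ℝ f)
        ((ContinuousLinearMap.lsmul ℝ ℝ).precompR (Eucl N)) volume x) x :=
      hfc.hasFDerivAt_convolution_right _ hlocρ hf x
    have he : convolution (ρ.normed volume) (fderiv ℝ f)
        ((ContinuousLinearMap.lsmul ℝ ℝ).precompR (Eucl N)) volume x
        = convolution (ρ.normed volume) (fderiv ℝ f) (ContinuousLinearMap.lsmul ℝ ℝ) volume x := by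
      refine integral_congr_ae (Eventually.of_forall fun t => ?_)
      ext w
      simp [ContinuousLinearMap.precompR_apply]
    rw [norm_gradient_sub_gradient, hd.fderiv, he, ← dist_eq_norm]
    refine ContDiffBump.dist_normed_convolution_le hcd.aestronglyMeasurable fun y hy => (h₂ ?_).le
    exact (Metric.mem_ball.1 hy).trans_le ((min_le_right _ _).trans (min_le_left _ _))

end Gradient

/-! ### The space `W₀^{1,p}(Ω)` -/

theorem tendsto_eLpNorm_of_uniform_approx {α E : Type*} [MeasurableSpace α] {μ : Measure α}
    [IsFiniteMeasure μ] [NormedAddCommGroup E] {q : ℝ≥0∞} (hq1 : 1 ≤ q) {f φ : ℕ → α → E}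
    {g : α → E} (hf : ∀ n, AEStronglyMeasurable (f n) μ) (hφ : ∀ n, AEStronglyMeasurable (φ n) μ)
    (hg : AEStronglyMeasurable g μ)
    (hfg : Tendsto (fun n => eLpNorm (fun x => f n x - g x) q μ) atTop (𝓝 0)) {δ : ℕ → ℝ}
    (hδ : Tendsto δ atTop (𝓝 0)) (hφf : ∀ n x, ‖φ n x - f n x‖ ≤ δ n) :
    Tendsto (fun n => eLpNorm (fun x => φ n x - g x) q μ) atTop (𝓝 0) := by
  have h1 : Tendsto (fun n => μ Set.univ ^ q.toReal⁻¹ * ENNReal.ofReal (δ n)) atTop (𝓝 0) := by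
    have h := ENNReal.Tendsto.const_mul (a := μ Set.univ ^ q.toReal⁻¹)
      (ENNReal.tendsto_ofReal hδ) (Or.inr (ENNReal.rpow_ne_top_of_nonneg (by positivity)
        (measure_ne_top μ _)))
    simpa using h
  refine tendsto_of_tendsto_of_tendsto_of_le_of_le tendsto_const_nhds (by simpa using h1.add hfg)
    (fun n => zero_le) fun n => ?_
  have hsplit : (fun x => φ n x - g x) = (fun x => φ n x - f n x) + fun x => f n x - g x := by
    ext x; simp
  rw [hsplit]
  refine (eLpNorm_add_le ((hφ n).sub (hf n)) ((hf n).sub hg) hq1).trans (add_le_add_left ?_ _)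
  exact eLpNorm_le_of_ae_bound (Eventually.of_forall (hφf n))

section Local

variable {N : ℕ} {Ω : Set (Eucl N)} {p : ℝ}

/-- A limit in `W^{1,p}` of compactly supported `C¹` functions in `Ω` belongs to `W₀^{1,p}(Ω)`,
and the limit of the gradients is its weak gradient. -/
theorem memSobolevOneZero_of_tendsto (hΩ : IsOpen Ω) (hΩb : Bornology.IsBounded Ω) (hp : 1 < p)
    {w : Eucl N → ℝ} (hw : MemLp w (ENNReal.ofReal p) volume) (hw0 : ∀ᵐ x, x ∉ Ω → w x = 0)
    {G : Eucl N → Eucl N} (hG : MemLp G (ENNReal.ofReal p) (volume.restrict Ω))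
    {f : ℕ → Eucl N → ℝ} (hf : ∀ n, ContDiff ℝ 1 (f n)) (hfc : ∀ n, HasCompactSupport (f n))
    (hfΩ : ∀ n, tsupport (f n) ⊆ Ω)
    (hfw : Tendsto (fun n => eLpNorm (fun x => f n x - w x) (ENNReal.ofReal p)
      (volume.restrict Ω)) atTop (𝓝 0))
    (hfG : Tendsto (fun n => eLpNorm (fun x => gradient (f n) x - G x) (ENNReal.ofReal p)
      (volume.restrict Ω)) atTop (𝓝 0)) :
    IsWeakGradient Ω w G ∧ MemSobolevOneZero Ω p w := by
  have : IsFiniteMeasure (volume.restrict Ω) := ⟨by simpa using hΩb.measure_lt_top⟩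
  have hq1 : 1 ≤ ENNReal.ofReal p := by simpa using hp.le
  have hwΩ := hw.restrict Ω
  have hmf : ∀ n, AEStronglyMeasurable (f n) (volume.restrict Ω) := fun n =>
    (hf n).continuous.aestronglyMeasurable
  have hmg : ∀ n, AEStronglyMeasurable (gradient (f n)) (volume.restrict Ω) := fun n =>
    (continuous_gradient (hf n)).aestronglyMeasurable
  have hweak : IsWeakGradient Ω w G := by
    refine ⟨IntegrableOn.locallyIntegrableOn (hwΩ.integrable hq1),
      IntegrableOn.locallyIntegrableOn (hG.integrable hq1), fun χ hχ => ?_⟩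
    have hχ1 : ContDiff ℝ 1 χ := hχ.1.of_le (by exact_mod_cast le_top)
    have hcχ := continuous_gradient hχ1
    obtain ⟨C, hC⟩ := (hasCompactSupport_gradient hχ.2.1).exists_bound_of_continuous hcχ
    obtain ⟨C', hC'⟩ := hχ.2.1.exists_bound_of_continuous hχ1.continuous
    have hl1 : Tendsto (fun n => ∫ x in Ω, f n x • gradient χ x) atTop
        (𝓝 (∫ x in Ω, w x • gradient χ x)) := by
      refine tendsto_integral_of_tendsto_eLpNorm hq1 hfw (fun n => (hmf n).sub hwΩ.1)
        (fun n => ?_) (hwΩ.1.smul hcχ.aestronglyMeasurable) (C := C) fun n x => ?_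
      · exact (((hf n).continuous.smul hcχ).integrable_of_hasCompactSupport
          (hfc n).smul_right).integrableOn
      · rw [← sub_smul, norm_smul, mul_comm]
        exact mul_le_mul_of_nonneg_right (hC x) (norm_nonneg _)
    have hl2 : Tendsto (fun n => ∫ x in Ω, χ x • gradient (f n) x) atTop
        (𝓝 (∫ x in Ω, χ x • G x)) := by
      refine tendsto_integral_of_tendsto_eLpNorm hq1 hfG (fun n => (hmg n).sub hG.1)
        (fun n => ?_) (hχ1.continuous.aestronglyMeasurable.smul hG.1) (C := C') fun n x => ?_
      · exact ((hχ1.continuous.smul (continuous_gradient (hf n))).integrable_of_hasCompactSupport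
          hχ.2.1.smul_right).integrableOn
      · rw [← smul_sub, norm_smul]
        exact mul_le_mul_of_nonneg_right (hC' x) (norm_nonneg _)
    refine tendsto_nhds_unique hl1 (hl2.neg.congr fun n => ?_)
    rw [setIntegral_smul_eq_integral hχ.2.2, setIntegral_smul_eq_integral (hfΩ n),
      integral_smul_gradient_eq_neg (hf n) hχ1 hχ.2.1]
  refine ⟨hweak, hw, hw0, G, hweak, hG, ?_⟩
  choose φ hφ h1 h2 using fun n : ℕ => exists_isTestFunction_approx hΩ (hf n) (hfc n) (hfΩ n)
    (Nat.one_div_pos_of_nat (α := ℝ) (n := n))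
  have hφ1 : ∀ n, ContDiff ℝ 1 (φ n) := fun n => (hφ n).1.of_le (by exact_mod_cast le_top)
  refine ⟨φ, hφ, ?_, ?_⟩
  · exact tendsto_eLpNorm_of_uniform_approx hq1 hmf
      (fun n => (hφ1 n).continuous.aestronglyMeasurable) hwΩ.1 hfw
      tendsto_one_div_add_atTop_nhds_zero_nat h1
  · exact tendsto_eLpNorm_of_uniform_approx hq1 hmg
      (fun n => (continuous_gradient (hφ1 n)).aestronglyMeasurable) hG.1 hfG
      tendsto_one_div_add_atTop_nhds_zero_nat h2

/-- Test functions approximating `u ∈ W₀^{1,p}(Ω)`, stated for the chosen weak gradient. -/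
theorem MemSobolevOneZero.exists_approx (hΩ : IsOpen Ω) {u : Eucl N → ℝ}
    (hu : MemSobolevOneZero Ω p u) :
    MemLp (weakGradient Ω u) (ENNReal.ofReal p) (volume.restrict Ω) ∧
      ∃ φ : ℕ → Eucl N → ℝ, (∀ n, IsTestFunction Ω (φ n)) ∧
        Tendsto (fun n => eLpNorm (fun x => φ n x - u x) (ENNReal.ofReal p) (volume.restrict Ω))
          atTop (𝓝 0) ∧
        Tendsto (fun n => eLpNorm (fun x => gradient (φ n) x - weakGradient Ω u x)
          (ENNReal.ofReal p) (volume.restrict Ω)) atTop (𝓝 0) := by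
  obtain ⟨-, -, g, hg, hgL, φ, hφ, h1, h2⟩ := hu
  have hae := weakGradient_ae_eq hΩ hg
  refine ⟨hgL.ae_eq hae.symm, φ, hφ, h1, h2.congr fun n => eLpNorm_congr_ae ?_⟩
  filter_upwards [hae] with x hx
  rw [hx]

theorem gradient_comp {F F₁ F₂ : ℝ × ℝ → ℝ} {K : ℝ} (hF : HasBoundedPartials F F₁ F₂ K)
    {φ ψ : Eucl N → ℝ} {x : Eucl N} (hφ : DifferentiableAt ℝ φ x) (hψ : DifferentiableAt ℝ ψ x) :
    gradient (fun x => F (φ x, ψ x)) x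
      = F₁ (φ x, ψ x) • gradient φ x + F₂ (φ x, ψ x) • gradient ψ x := by
  have h := (hF.hasFDerivAt (φ x, ψ x)).comp x (hφ.hasFDerivAt.prodMk hψ.hasFDerivAt)
  have h' : fderiv ℝ (fun x => F (φ x, ψ x)) x
      = F₁ (φ x, ψ x) • fderiv ℝ φ x + F₂ (φ x, ψ x) • fderiv ℝ ψ x := by
    refine h.fderiv.trans ?_
    ext w
    simp
  rw [gradient_eq_toDual_symm, h', map_add, map_smulₛₗ, map_smulₛₗ]
  rfl

theorem HasBoundedPartials.contDiff {F F₁ F₂ : ℝ × ℝ → ℝ} {K : ℝ}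
    (hF : HasBoundedPartials F F₁ F₂ K) : ContDiff ℝ 1 F :=
  contDiff_one_iff_hasFDerivAt.2 ⟨_, (hF.continuous_fst.smul continuous_const).add
    (hF.continuous_snd.smul continuous_const), hF.hasFDerivAt⟩

theorem exists_subseq_tendsto_ae {α E : Type*} [MeasurableSpace α] {μ : Measure α}
    [NormedAddCommGroup E] {q : ℝ≥0∞} (hq0 : q ≠ 0) {f : ℕ → α → E} {g : α → E}
    (hf : ∀ n, AEStronglyMeasurable (f n) μ) (hg : AEStronglyMeasurable g μ)
    (hfg : Tendsto (fun n => eLpNorm (fun x => f n x - g x) q μ) atTop (𝓝 0)) :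
    ∃ ns : ℕ → ℕ, StrictMono ns ∧ ∀ᵐ x ∂μ, Tendsto (fun n => f (ns n) x) atTop (𝓝 (g x)) :=
  (tendstoInMeasure_of_tendsto_eLpNorm hq0 hf hg hfg).exists_seq_tendsto_ae

/-- The chain rule in `W₀^{1,p}(Ω)`. -/
theorem MemSobolevOneZero.comp (hΩ : IsOpen Ω) (hΩb : Bornology.IsBounded Ω) (hp : 1 < p)
    {F F₁ F₂ : ℝ × ℝ → ℝ} {K : ℝ} (hF : HasBoundedPartials F F₁ F₂ K) {u v : Eucl N → ℝ}
    (hu : MemSobolevOneZero Ω p u) (hv : MemSobolevOneZero Ω p v) :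
    IsWeakGradient Ω (fun x => F (u x, v x))
        (fun x => F₁ (u x, v x) • weakGradient Ω u x + F₂ (u x, v x) • weakGradient Ω v x) ∧
      MemSobolevOneZero Ω p (fun x => F (u x, v x)) := by
  have : IsFiniteMeasure (volume.restrict Ω) := ⟨by simpa using hΩb.measure_lt_top⟩
  have hq1 : 1 ≤ ENNReal.ofReal p := by simpa using hp.le
  have hq0 : ENNReal.ofReal p ≠ 0 := (zero_lt_one.trans_le hq1).ne'
  have hq : ENNReal.ofReal p ≠ ⊤ := ENNReal.ofReal_ne_top
  have huΩ := hu.1.restrict Ω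
  have hvΩ := hv.1.restrict Ω
  obtain ⟨hgu, φ', hφ', hφu', hφg'⟩ := hu.exists_approx hΩ
  obtain ⟨hgv, ψ', hψ', hψv', hψg'⟩ := hv.exists_approx hΩ
  -- Along a common subsequence, both approximations converge almost everywhere as well.
  obtain ⟨ns, hns, hnsu⟩ := exists_subseq_tendsto_ae hq0
    (fun n => (hφ' n).1.continuous.aestronglyMeasurable) huΩ.1 hφu'
  obtain ⟨ms, hms, hmsv⟩ := exists_subseq_tendsto_ae hq0 (f := fun n => ψ' (ns n))
    (fun n => (hψ' (ns n)).1.continuous.aestronglyMeasurable) hvΩ.1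
    (hψv'.comp hns.tendsto_atTop)
  set φ : ℕ → Eucl N → ℝ := fun n => φ' (ns (ms n))
  set ψ : ℕ → Eucl N → ℝ := fun n => ψ' (ns (ms n))
  have hφ : ∀ n, IsTestFunction Ω (φ n) := fun n => hφ' _
  have hψ : ∀ n, IsTestFunction Ω (ψ n) := fun n => hψ' _
  have hφ1 : ∀ n, ContDiff ℝ 1 (φ n) := fun n => (hφ n).1.of_le (by exact_mod_cast le_top)
  have hψ1 : ∀ n, ContDiff ℝ 1 (ψ n) := fun n => (hψ n).1.of_le (by exact_mod_cast le_top)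
  have hsub : Tendsto (fun n => ns (ms n)) atTop atTop :=
    hns.tendsto_atTop.comp hms.tendsto_atTop
  have hφu := hφu'.comp hsub
  have hφg := hφg'.comp hsub
  have hψv := hψv'.comp hsub
  have hψg := hψg'.comp hsub
  have hae : ∀ᵐ x ∂(volume.restrict Ω),
      Tendsto (fun n => (φ n x, ψ n x)) atTop (𝓝 (u x, v x)) := by
    filter_upwards [hnsu, hmsv] with x h1 h2
    exact (h1.comp hms.tendsto_atTop).prodMk_nhds h2
  have hm : ∀ {k : ℝ × ℝ → ℝ}, Continuous k →
      (∀ n, AEStronglyMeasurable (fun x => k (φ n x, ψ n x)) (volume.restrict Ω)) ∧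
        AEStronglyMeasurable (fun x => k (u x, v x)) (volume.restrict Ω) := fun {k} hk =>
    ⟨fun n => (hk.comp ((hφ1 n).continuous.prodMk (hψ1 n).continuous)).aestronglyMeasurable,
      hk.comp_aestronglyMeasurable (huΩ.1.prodMk hvΩ.1)⟩
  have hmφ : ∀ n, AEStronglyMeasurable (φ n) (volume.restrict Ω) := fun n =>
    (hφ1 n).continuous.aestronglyMeasurable
  have hmψ : ∀ n, AEStronglyMeasurable (ψ n) (volume.restrict Ω) := fun n =>
    (hψ1 n).continuous.aestronglyMeasurable
  have hmgφ : ∀ n, AEStronglyMeasurable (gradient (φ n)) (volume.restrict Ω) := fun n =>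
    (continuous_gradient (hφ1 n)).aestronglyMeasurable
  have hmgψ : ∀ n, AEStronglyMeasurable (gradient (ψ n)) (volume.restrict Ω) := fun n =>
    (continuous_gradient (hψ1 n)).aestronglyMeasurable
  have hsupp : ∀ n, Function.support (fun x => F (φ n x, ψ n x)) ⊆
      tsupport (φ n) ∪ tsupport (ψ n) := fun n x hx => by
    by_contra hcon
    rw [Set.mem_union, not_or] at hcon
    refine hx ?_
    dsimp only
    rw [image_eq_zero_of_notMem_tsupport hcon.1, image_eq_zero_of_notMem_tsupport hcon.2]
    exact hF.zero
  have hbdd : ∀ {c : ℝ × ℝ → ℝ} {G : ℕ → Eucl N → Eucl N} {g : Eucl N → Eucl N},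
      Continuous c → (∀ z, |c z| ≤ K) →
      (∀ n, AEStronglyMeasurable (G n) (volume.restrict Ω)) →
      MemLp g (ENNReal.ofReal p) (volume.restrict Ω) →
      Tendsto (fun n => eLpNorm (fun x => G n x - g x) (ENNReal.ofReal p) (volume.restrict Ω))
        atTop (𝓝 0) →
      Tendsto (fun n => eLpNorm (fun x => c (φ n x, ψ n x) • G n x - c (u x, v x) • g x)
        (ENNReal.ofReal p) (volume.restrict Ω)) atTop (𝓝 0) := by
    intro c G g hc hcK hGm hg hGg
    refine tendsto_eLpNorm_smul_sub_smul hq1 hq (hm hc).1 (hm hc).2 (fun n x => hcK _)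
      (fun x => hcK _) ?_ hGm hg hGg
    filter_upwards [hae] with x hx
    exact (hc.tendsto _).comp hx
  have hbmem : ∀ {c : ℝ × ℝ → ℝ} {g : Eucl N → Eucl N}, Continuous c → (∀ z, |c z| ≤ K) →
      MemLp g (ENNReal.ofReal p) (volume.restrict Ω) →
      MemLp (fun x => c (u x, v x) • g x) (ENNReal.ofReal p) (volume.restrict Ω) := by
    intro c g hc hcK hg
    refine hg.of_le_mul ((hm hc).2.smul hg.1) (c := K) (Eventually.of_forall fun x => ?_)
    exact (norm_smul _ _).trans_le (mul_le_mul_of_nonneg_right (hcK _) (norm_nonneg _))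
  refine memSobolevOneZero_of_tendsto hΩ hΩb hp (memLp_comp hF hu.1 hv.1) ?_
    ((hbmem hF.continuous_fst hF.abs_fst_le hgu).add (hbmem hF.continuous_snd hF.abs_snd_le hgv))
    (f := fun n x => F (φ n x, ψ n x))
    (fun n => hF.contDiff.comp ((hφ1 n).prodMk (hψ1 n)))
    (fun n => HasCompactSupport.of_support_subset_isCompact
      ((hφ n).2.1.isCompact.union (hψ n).2.1.isCompact) (hsupp n))
    (fun n => (closure_minimal (hsupp n) ((isClosed_tsupport _).union (isClosed_tsupport _))).trans
      (Set.union_subset (hφ n).2.2 (hψ n).2.2)) ?_ ?_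
  · filter_upwards [hu.2.1, hv.2.1] with x h1 h2 hx
    rw [h1 hx, h2 hx]
    exact hF.zero
  · have hsum := hφu.add hψv
    have hlim : Tendsto (fun n => ENNReal.ofReal (2 * K) *
        (eLpNorm (fun x => φ n x - u x) (ENNReal.ofReal p) (volume.restrict Ω) +
          eLpNorm (fun x => ψ n x - v x) (ENNReal.ofReal p) (volume.restrict Ω))) atTop
        (𝓝 0) := by
      have h := ENNReal.Tendsto.const_mul hsum (Or.inr (ENNReal.ofReal_ne_top (r := 2 * K)))
      simpa using h
    refine tendsto_of_tendsto_of_tendsto_of_le_of_le tendsto_const_nhds hlim (fun n => zero_le)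
      fun n => ?_
    have h1 : AEStronglyMeasurable (fun x => φ n x - u x) (volume.restrict Ω) :=
      (hmφ n).sub huΩ.1
    have h2 : AEStronglyMeasurable (fun x => ψ n x - v x) (volume.restrict Ω) :=
      (hmψ n).sub hvΩ.1
    calc eLpNorm (fun x => F (φ n x, ψ n x) - F (u x, v x)) (ENNReal.ofReal p)
          (volume.restrict Ω)
        ≤ ENNReal.ofReal (2 * K) * eLpNorm ((fun x => ‖φ n x - u x‖) + fun x => ‖ψ n x - v x‖)
            (ENNReal.ofReal p) (volume.restrict Ω) := by
          refine eLpNorm_le_mul_eLpNorm_of_ae_le_mul (Eventually.of_forall fun x => ?_) _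
          refine (hF.abs_sub_le (φ n x, ψ n x) (u x, v x)).trans ?_
          exact mul_le_mul_of_nonneg_left (le_abs_self _) (mul_nonneg zero_le_two hF.nonneg)
      _ ≤ _ := by
          gcongr
          refine (eLpNorm_add_le h1.norm h2.norm hq1).trans_eq ?_
          rw [eLpNorm_norm, eLpNorm_norm]
  · have hsum := (hbdd hF.continuous_fst hF.abs_fst_le hmgφ hgu hφg).add
      (hbdd hF.continuous_snd hF.abs_snd_le hmgψ hgv hψg)
    rw [add_zero] at hsum
    refine tendsto_of_tendsto_of_tendsto_of_le_of_le tendsto_const_nhds hsum (fun n => zero_le)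
      fun n => ?_
    have h1 := ((hm hF.continuous_fst).1 n).smul (hmgφ n)
    have h2 := ((hm hF.continuous_fst).2).smul hgu.1
    have h3 := ((hm hF.continuous_snd).1 n).smul (hmgψ n)
    have h4 := ((hm hF.continuous_snd).2).smul hgv.1
    refine le_trans (le_of_eq ?_) (eLpNorm_add_le (h1.sub h2) (h3.sub h4) hq1)
    congr 1
    ext1 x
    rw [gradient_comp hF ((hφ1 n).differentiable one_ne_zero x)
      ((hψ1 n).differentiable one_ne_zero x)]
    exact add_sub_add_comm _ _ _ _

theorem normW0_one_rpow (hp : 0 < p) (u : Eucl N → ℝ) :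
    normW0 Ω 1 p u ^ p = ∫ x in Ω, ‖weakGradient Ω u x‖ ^ p := by
  rw [normW0, if_pos rfl, ← Real.rpow_mul (integral_nonneg fun x => by positivity),
    one_div_mul_cancel hp.ne', Real.rpow_one]

theorem formA_one_self (hp : 0 < p) (v : Eucl N → ℝ) :
    formA Ω 1 p v v = normW0 Ω 1 p v ^ p := by
  rw [normW0_one_rpow hp, formA, if_pos rfl]
  refine integral_congr_ae (Eventually.of_forall fun x => ?_)
  have h := abs_rpow_sub_two_mul_self_mul_self hp ‖weakGradient Ω v x‖
  rw [abs_norm] at h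
  simp only [real_inner_self_eq_norm_sq]
  rw [← h]
  ring

theorem normW0_one_const_mul (hΩ : IsOpen Ω) (hΩb : Bornology.IsBounded Ω) (hp : 1 < p) {c : ℝ}
    (hc : 0 ≤ c) {v : Eucl N → ℝ} (hv : MemSobolevOneZero Ω p v) :
    normW0 Ω 1 p (fun x => c * v x) ^ p = c ^ p * normW0 Ω 1 p v ^ p := by
  rw [normW0_one_rpow (by linarith), normW0_one_rpow (by linarith), ← integral_const_mul]
  refine integral_congr_ae ?_
  filter_upwards [weakGradient_ae_eq hΩ
    (hv.comp hΩ hΩb hp (hasBoundedPartials_const_mul_fst c) hv).1] with x hx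
  rw [hx, zero_smul, add_zero, norm_smul, Real.norm_of_nonneg hc,
    Real.mul_rpow hc (norm_nonneg _)]

theorem formA_one_piconeProfile_le (hΩ : IsOpen Ω) (hΩb : Bornology.IsBounded Ω) (hp : 1 < p)
    {u v : Eucl N → ℝ} (hu : MemSobolevOneZero Ω p u) (hv : MemSobolevOneZero Ω p v)
    (hv0 : ∀ᵐ x, 0 ≤ v x) {ε : ℝ} (hε : 0 < ε) :
    formA Ω 1 p v (fun x => piconeProfile p ε (u x, v x)) ≤ normW0 Ω 1 p u ^ p := by
  rw [normW0_one_rpow (by linarith), formA, if_pos rfl]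
  obtain ⟨K, hF⟩ := hasBoundedPartials_piconeProfile hp hε
  refine integral_le_integral_of_nonneg_right ?_ (fun x => by positivity) ?_
  · have h := (hu.exists_approx hΩ).1.integrable_norm_rpow
      (ENNReal.ofReal_pos.2 (by linarith)).ne' ENNReal.ofReal_ne_top
    rwa [ENNReal.toReal_ofReal (by linarith)] at h
  · filter_upwards [weakGradient_ae_eq hΩ (hu.comp hΩ hΩb hp hF hv).1, ae_restrict_of_ae hv0]
      with x hx hvx
    rw [hx]
    have hw : 0 < v x + ε := by linarith
    set g := Real.arctan (ε * u x) / ε with hg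
    -- With `t = |g(u)| / (v + ε)`; the factor `g'(u) ≤ 1` is absorbed in the bound on `α`.
    refine picone_inner hp (div_nonneg (abs_nonneg g) hw.le) ?_ ?_ _ _
    · rw [abs_mul, dampedPow_of_nonneg hε hvx, abs_of_nonneg (Real.rpow_nonneg hw.le _),
        Real.div_rpow (abs_nonneg _) hw.le, ← neg_sub p 1, Real.rpow_neg hw.le, ← div_eq_mul_inv,
        ← mul_div_assoc]
      exact div_le_div_of_nonneg_right (abs_truncPowDeriv_le hp _) (by positivity)
    · rw [truncPow, ← hg, abs_of_nonneg hvx, Real.rpow_neg hw.le,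
        Real.div_rpow (abs_nonneg _) hw.le]
      ring

end Local

/-! ### Testing the equation with the Picone profile -/

section Unified

variable {N : ℕ} {Ω : Set (Eucl N)} {s p : ℝ} {u v : Eucl N → ℝ}

theorem MemW0.comp (hΩ : IsOpen Ω) (hΩb : Bornology.IsBounded Ω) (hp : 1 < p)
    {F F₁ F₂ : ℝ × ℝ → ℝ} {K : ℝ} (hF : HasBoundedPartials F F₁ F₂ K) (hu : MemW0 Ω s p u)
    (hv : MemW0 Ω s p v) : MemW0 Ω s p (fun x => F (u x, v x)) := by
  unfold MemW0 at *
  split_ifs at * with hs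
  · exact (hu.comp hΩ hΩb hp hF hv).2
  · exact hu.comp (by linarith) hF hv

theorem MemW0.memLp_and_ae_eq_zero (hu : MemW0 Ω s p u) :
    MemLp u (ENNReal.ofReal p) volume ∧ ∀ᵐ x, x ∉ Ω → u x = 0 := by
  unfold MemW0 at hu
  split_ifs at hu
  · exact ⟨hu.1, hu.2.1⟩
  · exact ⟨hu.1.1, hu.2⟩

theorem formA_self (hp : 0 < p) (v : Eucl N → ℝ) : formA Ω s p v v = normW0 Ω s p v ^ p := by
  rcases eq_or_ne s 1 with rfl | hs
  · exact formA_one_self hp v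
  · exact formA_self_of_ne_one hs hp v

theorem normW0_const_mul (hΩ : IsOpen Ω) (hΩb : Bornology.IsBounded Ω) (hp : 1 < p) {c : ℝ}
    (hc : 0 ≤ c) (hv : MemW0 Ω s p v) :
    normW0 Ω s p (fun x => c * v x) ^ p = c ^ p * normW0 Ω s p v ^ p := by
  rcases eq_or_ne s 1 with rfl | hs
  · exact normW0_one_const_mul hΩ hΩb hp hc (by simpa [MemW0] using hv)
  · exact normW0_const_mul_of_ne_one hs (by linarith) hc v

/-- The Picone inequality in integrated form. -/
theorem formA_piconeProfile_le (hΩ : IsOpen Ω) (hΩb : Bornology.IsBounded Ω) (hp : 1 < p)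
    (hu : MemW0 Ω s p u) (hv : MemW0 Ω s p v) (hv0 : ∀ᵐ x, 0 ≤ v x) {ε : ℝ} (hε : 0 < ε) :
    formA Ω s p v (fun x => piconeProfile p ε (u x, v x)) ≤ normW0 Ω s p u ^ p := by
  rcases eq_or_ne s 1 with rfl | hs
  · exact formA_one_piconeProfile_le hΩ hΩb hp (by simpa [MemW0] using hu)
      (by simpa [MemW0] using hv) hv0 hε
  · exact formA_piconeProfile_le_of_ne_one hs hp (by simpa [MemW0, hs] using hu) hv0 hε

theorem ae_nonneg_of_ae_pos (hΩ : IsOpen Ω) (hv0 : ∀ᵐ x, x ∉ Ω → v x = 0)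
    (hvpos : ∀ᵐ x ∂(volume.restrict Ω), 0 < v x) : ∀ᵐ x, 0 ≤ v x := by
  filter_upwards [hv0, (ae_restrict_iff' hΩ.measurableSet).1 hvpos] with x h0 h1
  by_cases hx : x ∈ Ω
  · exact (h1 hx).le
  · exact (h0 hx).ge

theorem abs_rpow_sub_two_mul_of_pos {p t : ℝ} (ht : 0 < t) :
    |t| ^ (p - 2) * t = t ^ (p - 1) := by
  rw [abs_of_pos ht, ← Real.rpow_add_one ht.ne']
  ring_nf

/-- Testing the equation of a positive solution `v` with the regularized `|u|^p / v^(p-1)`, and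
letting the regularization tend to zero. The integrable function `|h| |u|^p` dominates. -/
theorem mul_integral_le_normW0_rpow (hΩ : IsOpen Ω) (hΩb : Bornology.IsBounded Ω) (hp : 1 < p)
    {h : Eucl N → ℝ} (hh : AEMeasurable h (volume.restrict Ω)) {lam : ℝ}
    (hv : IsWeakSolution Ω s p (fun x t => lam * h x * |t| ^ (p - 2) * t) v)
    (hvpos : ∀ᵐ x ∂(volume.restrict Ω), 0 < v x) (hu : MemW0 Ω s p u)
    (hint : IntegrableOn (fun x => h x * |u x| ^ p) Ω) :
    lam * ∫ x in Ω, h x * |u x| ^ p ≤ normW0 Ω s p u ^ p := by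
  have hv0 := ae_nonneg_of_ae_pos hΩ hv.1.memLp_and_ae_eq_zero.2 hvpos
  have hum := (hu.memLp_and_ae_eq_zero.1.restrict Ω).aestronglyMeasurable
  have hvm := (hv.1.memLp_and_ae_eq_zero.1.restrict Ω).aestronglyMeasurable
  set ε : ℕ → ℝ := fun n => 1 / ((n : ℝ) + 1)
  have hε : ∀ n, 0 < ε n := fun n => Nat.one_div_pos_of_nat
  have hε0 : Tendsto ε atTop (𝓝 0) := tendsto_one_div_add_atTop_nhds_zero_nat
  rw [← integral_const_mul]
  refine le_of_tendsto (x := atTop) (f := fun n => ∫ x in Ω,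
    lam * h x * |v x| ^ (p - 2) * v x * piconeProfile p (ε n) (u x, v x)) ?_
    (Eventually.of_forall fun n => ?_)
  · refine tendsto_integral_of_dominated_convergence (fun x => |lam| * ‖h x * |u x| ^ p‖)
      (fun n => ?_) (hint.norm.const_mul _) (fun n => ?_) ?_
    · obtain ⟨K, hF⟩ := hasBoundedPartials_piconeProfile hp (hε n)
      have h1 : AEMeasurable (fun x => lam * h x * |v x| ^ (p - 2) * v x) (volume.restrict Ω) :=
        (((hh.const_mul lam).mul (hvm.aemeasurable.norm.pow_const (p - 2))).mul
          hvm.aemeasurable)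
      exact h1.aestronglyMeasurable.mul
        (hF.continuous.comp_aestronglyMeasurable (hum.prodMk hvm))
    · filter_upwards [hvpos] with x hx
      have hw : 0 < v x + ε n := add_pos hx (hε n)
      have h1 : v x ^ (p - 1) * (v x + ε n) ^ (1 - p) ≤ 1 := by
        rw [← neg_sub p 1, Real.rpow_neg hw.le, ← div_eq_mul_inv,
          div_le_one (Real.rpow_pos_of_pos hw _)]
        exact Real.rpow_le_rpow hx.le (by linarith [hε n]) (by linarith)
      have h0 : 0 ≤ v x ^ (p - 1) * (v x + ε n) ^ (1 - p) := by positivity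
      calc ‖lam * h x * |v x| ^ (p - 2) * v x * piconeProfile p (ε n) (u x, v x)‖
          = ‖(lam * h x) * (truncPow p (ε n) (u x) *
              (v x ^ (p - 1) * (v x + ε n) ^ (1 - p)))‖ := by
            rw [mul_assoc (lam * h x), abs_rpow_sub_two_mul_of_pos hx, piconeProfile,
              dampedPow_of_nonneg (hε n) hx.le]
            ring_nf
        _ = |lam| * (|h x| * (truncPow p (ε n) (u x) *
              (v x ^ (p - 1) * (v x + ε n) ^ (1 - p)))) := by
            rw [norm_mul, norm_mul, Real.norm_of_nonneg (mul_nonneg (truncPow_nonneg _ _ _) h0),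
              mul_assoc]
            rfl
        _ ≤ |lam| * (|h x| * (|u x| ^ p * 1)) := by
            have := truncPow_le_abs_rpow hp (hε n) (u x)
            gcongr
        _ = |lam| * ‖h x * |u x| ^ p‖ := by
            rw [mul_one, norm_mul, Real.norm_of_nonneg (by positivity : 0 ≤ |u x| ^ p)]
            rfl
    · filter_upwards [hvpos] with x hx
      have h1 : Tendsto (fun n => (v x + ε n) ^ (1 - p)) atTop (𝓝 (v x ^ (1 - p))) := by
        have h2 : Tendsto (fun n => v x + ε n) atTop (𝓝 (v x)) := by
          simpa using hε0.const_add (v x)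
        exact h2.rpow_const (Or.inl hx.ne')
      have h2 := ((tendsto_truncPow hp (u x) hε hε0).mul h1).const_mul
        (lam * h x * |v x| ^ (p - 2) * v x)
      have h3 : v x ^ (p - 1) * v x ^ (1 - p) = 1 := by
        rw [← Real.rpow_add hx]; simp
      have h4 : lam * h x * |v x| ^ (p - 2) * v x * (|u x| ^ p * v x ^ (1 - p))
          = lam * (h x * |u x| ^ p) := by
        rw [mul_assoc (lam * h x), abs_rpow_sub_two_mul_of_pos hx]
        linear_combination (lam * h x * |u x| ^ p) * h3
      rw [h4] at h2
      refine h2.congr fun n => ?_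
      rw [piconeProfile, dampedPow_of_nonneg (hε n) hx.le]
  · obtain ⟨K, hF⟩ := hasBoundedPartials_piconeProfile hp (hε n)
    exact (hv.2.2 _ (hu.comp hΩ hΩb hp hF hv.1)).symm.trans_le
      (formA_piconeProfile_le hΩ hΩb hp hu hv.1 hv0 (hε n))

end Unified

end FracPLaplace

open FracPLaplace in
theorem theorem3p6 (N : ℕ) (hN : 1 ≤ N) (Ω : Set (FracPLaplace.Eucl N)) (hΩ : IsOpen Ω)
    (hΩb : Bornology.IsBounded Ω) (s p : ℝ) (hs0 : 0 < s) (hs1 : s ≤ 1) (hp : 1 < p)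
    (h : FracPLaplace.Eucl N → ℝ) (hh : FracPLaplace.WeightTilde Ω s p p h)
    (lam : ℝ) (v : FracPLaplace.Eucl N → ℝ)
    (hv : FracPLaplace.IsEigenfunction Ω s p h lam v)
    (hvpos : ∀ᵐ x ∂(volume.restrict Ω), 0 < v x)
    (hint : 0 < ∫ x in Ω, h x * v x ^ p) :
    lam = FracPLaplace.firstEigenvalue Ω s p h := by
  have hp0 : 0 < p := by linarith
  obtain ⟨-, hsol⟩ := hv
  set I := ∫ x in Ω, h x * v x ^ p with hI
  refine (IsLeast.csInf_eq ⟨?_, ?_⟩).symm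
  -- The infimum is attained at the multiple `c v` of the eigenfunction.
  · have hnorm : normW0 Ω s p v ^ p = lam * I := by
      rw [← formA_self hp0, hsol.2.2 v hsol.1, hI, ← integral_const_mul]
      refine integral_congr_ae ?_
      filter_upwards [hvpos] with x hx
      rw [mul_assoc (lam * h x), mul_assoc (lam * h x), abs_rpow_sub_two_mul_self_mul_self hp0,
        abs_of_pos hx, mul_assoc]
    have hc : 0 ≤ I ^ (-(1 / p)) := by positivity
    have hcp : (I ^ (-(1 / p))) ^ p = I⁻¹ := by
      rw [← Real.rpow_mul hint.le, neg_mul, one_div_mul_cancel hp0.ne', Real.rpow_neg_one]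
    refine ⟨fun x => I ^ (-(1 / p)) * v x,
      hsol.1.comp hΩ hΩb hp (hasBoundedPartials_const_mul_fst _) hsol.1, ?_, ?_⟩
    · calc ∫ x in Ω, h x * |I ^ (-(1 / p)) * v x| ^ p
          = ∫ x in Ω, I⁻¹ * (h x * v x ^ p) := by
            refine integral_congr_ae ?_
            filter_upwards [hvpos] with x hx
            rw [abs_of_nonneg (mul_nonneg hc hx.le), Real.mul_rpow hc hx.le, hcp]
            ring
        _ = 1 := by rw [integral_const_mul, ← hI, inv_mul_cancel₀ hint.ne']
    · rw [normW0_const_mul hΩ hΩb hp hc hsol.1, hcp, hnorm]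
      field_simp
  · rintro _ ⟨u, hu, hu1, rfl⟩
    -- A nonintegrable function would have Bochner integral `0`.
    have hui : IntegrableOn (fun x => h x * |u x| ^ p) Ω :=
      Integrable.of_integral_ne_zero (by rw [hu1]; exact one_ne_zero)
    simpa [hu1] using mul_integral_le_normW0_rpow hΩ hΩb hp hh.1 hsol hvpos hu hui
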